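/- Let $G=(V,E,\omega)$ be an undirected graph on $n\ge 3$ vertices with positive edge weights, let $d_G$ be its weighted distance ($d_G(u,v)=\infty$ if $u,v$ are not connected), let $h=\lceil\log_{4/3}(\log_2 n+1)\rceil$, and for $1\le i\le h$ let $\rho_i=(2n)^{1-(3/4)^{h-i+1}}$. Sample sets $L_1,\dots,L_h\subseteq V$ by putting every vertex into $L_i$ with probability $\min(1,\rho_i/n)$, independently over all vertices and all levels; then $L_1=V$ almost surely. Let $r_i(v)=\min_{l\in L_i}d_G(v,l)$ ($\infty$ if no element of $L_i$ is reachable from $v$). For $i<h$ let $\mathcal P_i$ be the set of pairs of distinct $u,v\in L_i$ with $d_G(u,v)<\frac13 r_{i+1}(u)$ or $d_G(u,v)<\frac13 r_{i+1}(v)$, and let $\mathcal P_h$ be the set of all pairs of distinct, mutually reachable elements of $L_h$. The oracle $\tilde\Lambda$ stores in hash tables, for each level $i$: (a) a forest of vertex-disjoint shortest-path trees rooted at $L_i$, in which every vertex that can reach $L_i$ lies in the tree of a closest $i$-landmark $\ell_i(v)$; (b) a distance-preserving path-reporting oracle for $\mathcal P_i$. For the latter, one fixes shortest paths $\Pi_{x,y}$,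 $(x,y)\in\mathcal P_i$, with $\Pi_{y,x}$ the reverse of $\Pi_{x,y}$, such that two of the paths that traverse the same two vertices in the same order share the subpath between them, and one stores the first and the last edge of each path; for each internal vertex of the paths, the name of one path through it (its home path) and the two edges of this path at the vertex; and for each branching event (two distinct paths and a common vertex $x$ at which their sets $\{\mathrm{pred}(x),\mathrm{succ}(x)\}$ differ) the at most four edges of the two paths at the vertex. Edges are stored with their weights. Given $u,v$, the query algorithm puts $u^{(1)}=u$, $v^{(1)}=v$ and for $j=1,2,\dots$ does the following. If $u^{(j)}=v^{(j)}$ or $(u^{(j)},v^{(j)})\in\mathcal P_j$ then it reports the concatenation of the tree paths from $u$ to $u^{(j)}$, the stored shortest path from $u^{(j)}$ to $v^{(j)}$ (recovered edge by edge), and the reversed tree paths from $v^{(j)}$ to $v$; otherwise it follows the trees to $u^{(j+1)}=\ell_{j+1}(u^{(j)})$ and $v^{(j+1)}=\ell_{j+1}(v^{(j)})$. It runs on a random access machine with unit-cost hash table lookups that has access only to the stored tables and to the names of $u$ and $v$, not to $G$. Space is the total number of memory words in all tables, where a word holds either an integer of size $O(n)$ or a weight. **Theorem.** The choices of trees and paths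 described above always exist, and for every way of making them $\tilde\Lambda$ is a path-reporting distance oracle with the following properties, the constants in the $O(\cdot)$ being absolute. 1. The expected space of $\tilde\Lambda$ is $O(n\log\log n)$, regardless of the number of edges of $G$. 2. Whenever $L_1=V$, for all $u,v$ that are connected in $G$ the query algorithm reports a path (walk) $\Pi$ in $G$ from $u$ to $v$, together with its length $\omega(\Pi)$, such that $d_G(u,v)\le\omega(\Pi)\le O\big(\log^{\log_{4/3}7}n\big)\cdot d_G(u,v)$. 3. The worst-case query time is $O(\log\log n+|\Pi|)$, where $|\Pi|$ is the number of edges of the reported path. 4. The additive term $\log\log n$ can be absorbed by $|\Pi|$: if every vertex that was sampled into several of $L_2,\dots,L_h$ is kept only in the highest of them, so that these sets are pairwise disjoint, then properties 1 and 2 remain true and the query time is $O(1+|\Pi|)$. -/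

import Mathlib

open MeasureTheory ProbabilityTheory
open scoped NNReal ENNReal

namespace PathOracle

/-! ### Weighted distances -/

section Distances

variable {n : ℕ}

/-- The length `ω(p)` of a walk, the sum of the weights of its edges. -/
def walkWeight {G : SimpleGraph (Fin n)} (ω : Sym2 (Fin n) → ℝ≥0) {u v : Fin n}
    (p : G.Walk u v) : ℝ≥0 :=
  (p.edges.map ω).sum

/-- The distance `d_G(u, v)`; it is `∞` if `v` cannot be reached from `u`. -/
noncomputable def wdist (G : SimpleGraph (Fin n)) (ω : Sym2 (Fin n) → ℝ≥0) (u v : Fin n) : ℝ≥0∞ :=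
  ⨅ p : G.Walk u v, (walkWeight ω p : ℝ≥0∞)

/-- The distance from `v` to the closest element of `A`; it is `∞` if there is none. -/
noncomputable def radius (G : SimpleGraph (Fin n)) (ω : Sym2 (Fin n) → ℝ≥0) (A : Set (Fin n))
    (v : Fin n) : ℝ≥0∞ :=
  ⨅ l ∈ A, wdist G ω v l

/-- The `c`-fraction-ball of `v` with respect to the landmark set `A`. -/
def fractionBall (G : SimpleGraph (Fin n)) (ω : Sym2 (Fin n) → ℝ≥0) (c : ℝ≥0∞)
    (A : Set (Fin n)) (v : Fin n) : Set (Fin n) :=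
  {x | wdist G ω v x < c * radius G ω A v}

end Distances

/-! ### The landmark hierarchy -/

/-- The number of levels `h = log_{4/3} (log_2 n + 1)`, rounded up. -/
noncomputable def levels (n : ℕ) : ℕ :=
  ⌈Real.logb (4 / 3) (Real.logb 2 n + 1)⌉₊

/-- `ρ_i = (2 n) ^ α_i` with `α_i = 1 - (3/4) ^ (h - i + 1)`, for `1 ≤ i ≤ h`. -/
noncomputable def rho (n i : ℕ) : ℝ :=
  (2 * (n : ℝ)) ^ (1 - (3 / 4 : ℝ) ^ (levels n + 1 - i))

/-- The sampling probability `ρ_i / n`, clipped to `[0, 1]`. -/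
noncomputable def sampleProb (n i : ℕ) : unitInterval :=
  Set.projIcc (0 : ℝ) 1 zero_le_one (rho n i / n)

/-- The outcomes of the sampling: one vertex set for each level `1, …, h`. -/
abbrev Sample (n : ℕ) : Type := Finset.Icc 1 (levels n) → Set (Fin n)

/-- Every vertex is selected into level `i` with probability `ρ_i / n`, independently over all
vertices and all levels. -/
noncomputable def sampling (n : ℕ) : Measure (Sample n) :=
  Measure.pi fun i => setBernoulli (Set.univ : Set (Fin n)) (sampleProb n i)

open Classical in
/-- The landmark sets `L_1, …, L_h`. -/
noncomputable def landmarks {n : ℕ} (S : Sample n) (i : ℕ) : Set (Fin n) :=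
  if hi : i ∈ Finset.Icc 1 (levels n) then S ⟨i, hi⟩ else ∅

/-- The landmark sets made disjoint above level 1: a vertex sampled into several levels `≥ 2` is
kept only in the highest of them. -/
noncomputable def disjointLandmarks {n : ℕ} (S : Sample n) (i : ℕ) : Set (Fin n) :=
  if i = 1 then landmarks S 1 else landmarks S i \ ⋃ j > i, landmarks S j

/-- The pairs `P_i` of `i`-landmarks: on the levels `i < h` those for which one endpoint lies in the
one-third-ball of the other one, on the top level all pairs (between which there is a path). -/
def landmarkPairs {n : ℕ} (G : SimpleGraph (Fin n)) (ω : Sym2 (Fin n) → ℝ≥0) (h : ℕ)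
    (L : ℕ → Set (Fin n)) (i : ℕ) : Set (Fin n × Fin n) :=
  {a | a.1 ≠ a.2 ∧ a.1 ∈ L i ∧ a.2 ∈ L i ∧
    if i < h then
      a.2 ∈ fractionBall G ω (1 / 3) (L (i + 1)) a.1 ∨ a.1 ∈ fractionBall G ω (1 / 3) (L (i + 1)) a.2
    else G.Reachable a.1 a.2}

/-! ### The components of the oracle -/

section Components

variable {n : ℕ}

/-- A forest of vertex-disjoint shortest path trees rooted at the elements of `A`: every vertex from
which `A` can be reached lies in the tree of one of its closest elements of `A`, ties being broken
arbitrarily. Roots are their own parents. -/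
structure Forest (G : SimpleGraph (Fin n)) (ω : Sym2 (Fin n) → ℝ≥0) (A : Set (Fin n)) where
  near : Fin n → Fin n
  parent : Fin n → Fin n
  near_mem : ∀ v, radius G ω A v ≠ ⊤ → near v ∈ A
  near_closest : ∀ v, radius G ω A v ≠ ⊤ → wdist G ω v (near v) = radius G ω A v
  parent_root : ∀ v, radius G ω A v ≠ ⊤ → near v = v → parent v = v
  parent_adj : ∀ v, radius G ω A v ≠ ⊤ → near v ≠ v → G.Adj v (parent v)
  parent_near : ∀ v, radius G ω A v ≠ ⊤ → near v ≠ v → near (parent v) = near v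
  parent_dist : ∀ v, radius G ω A v ≠ ⊤ → near v ≠ v →
    wdist G ω v (near v) = ω s(v, parent v) + wdist G ω (parent v) (near v)

/-- The predecessor of `x` in a path, `none` standing for NULL. -/
def predIn (l : List (Fin n)) (x : Fin n) : Option (Fin n) :=
  if l.idxOf x = 0 then none else l[l.idxOf x - 1]?

/-- The successor of `x` in a path, `none` standing for NULL. -/
def succIn (l : List (Fin n)) (x : Fin n) : Option (Fin n) :=
  l[l.idxOf x + 1]?

/-- The choices behind a distance-preserving path-reporting oracle for the set `P` of pairs: a
shortest path (as the list of its vertices) for each pair, such that two paths that traverse `x` and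
later `y` share the subpath from `x` to `y`, the path of a reversed pair being the reversed path;
and, for every vertex that is internal to one of the paths, (the name of) such a path, its home
path. All choices are arbitrary otherwise. -/
structure Dppro (G : SimpleGraph (Fin n)) (ω : Sym2 (Fin n) → ℝ≥0) (P : Set (Fin n × Fin n)) where
  path : Fin n × Fin n → List (Fin n)
  home : Fin n → Fin n × Fin n
  path_shortest : ∀ a ∈ P, ∃ w : G.Walk a.1 a.2,
    w.support = path a ∧ (walkWeight ω w : ℝ≥0∞) = wdist G ω a.1 a.2
  path_swap : ∀ a ∈ P, a.swap ∈ P → path a.swap = (path a).reverse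
  path_consistent : ∀ a ∈ P, ∀ b ∈ P, ∀ (x y : Fin n) (m m' : List (Fin n)),
    x :: (m ++ [y]) <:+: path a → x :: (m' ++ [y]) <:+: path b → m = m'
  home_spec : ∀ x, (∃ a ∈ P, x ∈ path a ∧ x ≠ a.1 ∧ x ≠ a.2) →
    home x ∈ P ∧ x ∈ path (home x) ∧ x ≠ (home x).1 ∧ x ≠ (home x).2

variable {G : SimpleGraph (Fin n)} {ω : Sym2 (Fin n) → ℝ≥0} {P : Set (Fin n × Fin n)}

/-- `x` is an internal vertex of one of the paths. -/
def Dppro.IsInternal (D : Dppro G ω P) (x : Fin n) : Prop :=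
  ∃ a ∈ P, x ∈ D.path a ∧ x ≠ a.1 ∧ x ≠ a.2

/-- The paths of the pairs `a` and `b` are distinct and branch at the vertex `x`. -/
def Dppro.IsBranching (D : Dppro G ω P) (a b : Fin n × Fin n) (x : Fin n) : Prop :=
  a ∈ P ∧ b ∈ P ∧ D.path a ≠ D.path b ∧ x ∈ D.path a ∧ x ∈ D.path b ∧
    s(predIn (D.path a) x, succIn (D.path a) x) ≠ s(predIn (D.path b) x, succIn (D.path b) x)

end Components

/-- The oracle for the landmark sets `L_1, …, L_h`: a forest and a distance-preserving
path-reporting oracle for each level. -/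
structure Oracle {n : ℕ} (G : SimpleGraph (Fin n)) (ω : Sym2 (Fin n) → ℝ≥0) (h : ℕ)
    (L : ℕ → Set (Fin n)) where
  forest : ∀ i, Forest G ω (L i)
  dppro : ∀ i, Dppro G ω (landmarkPairs G ω h L i)

/-! ### Memory -/

/-- A record of a hash table: a key and the data stored for it. A memory word holds an integer or a
weight. -/
structure Entry where
  key : List ℕ
  ids : List ℕ
  wts : List ℝ≥0

/-- The number of words that a record occupies. -/
def Entry.size (e : Entry) : ℕ := e.key.length + e.ids.length + e.wts.length

/-- The contents of the hash tables. -/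
abbrev Memory : Type := Finset Entry

/-- The space: the total number of words of all records. -/
def Memory.space (M : Memory) : ℕ := ∑ e ∈ M, e.size

open Classical in
/-- The record stored under a key, if there is one. -/
noncomputable def Memory.lookup (M : Memory) (k : List ℕ) : Option Entry :=
  if h : ∃ e ∈ M, e.key = k then some h.choose else none

section Tables

open Classical

variable {n : ℕ} {G : SimpleGraph (Fin n)} {ω : Sym2 (Fin n) → ℝ≥0}

/-- The word for a vertex or for NULL. -/
def code : Option (Fin n) → ℕ
  | some v => v
  | none => n

/-- The weight of the edge between `x` and `y`, and `0` if there is no such edge. -/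
noncomputable def edgeWt (G : SimpleGraph (Fin n)) (ω : Sym2 (Fin n) → ℝ≥0) (x : Fin n) :
    Option (Fin n) → ℝ≥0
  | some y => if G.Adj x y then ω s(x, y) else 0
  | none => 0

/-- Table 0: for each vertex of a tree, its parent and the weight of the edge to it. -/
noncomputable def Forest.table {A : Set (Fin n)} (F : Forest G ω A) (i : ℕ) : Memory :=
  (Finset.univ.filter fun v => radius G ω A v ≠ ⊤).image fun v : Fin n =>
    ⟨[0, i, v], [F.parent v], [edgeWt G ω v (some (F.parent v))]⟩

variable {P : Set (Fin n × Fin n)}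

/-- Table 1: for each pair, the first and the last edge of its path. -/
noncomputable def Dppro.pairTable (D : Dppro G ω P) (i : ℕ) : Memory :=
  (Finset.univ.filter fun a => a ∈ P).image fun a : Fin n × Fin n =>
    ⟨[1, i, a.1, a.2], [code (succIn (D.path a) a.1), code (predIn (D.path a) a.2)],
      [edgeWt G ω a.1 (succIn (D.path a) a.1), edgeWt G ω a.2 (predIn (D.path a) a.2)]⟩

/-- Table 2: for each internal vertex, the name of its home path and the two edges of this path that
are incident on it. -/
noncomputable def Dppro.homeTable (D : Dppro G ω P) (i : ℕ) : Memory :=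
  (Finset.univ.filter fun x => D.IsInternal x).image fun x : Fin n =>
    ⟨[2, i, x],
      [(D.home x).1, (D.home x).2, code (predIn (D.path (D.home x)) x),
        code (succIn (D.path (D.home x)) x)],
      [edgeWt G ω x (predIn (D.path (D.home x)) x), edgeWt G ω x (succIn (D.path (D.home x)) x)]⟩

/-- Table 3: for each branching event, the (at most four) edges of the two paths that are incident
on the vertex. -/
noncomputable def Dppro.branchTable (D : Dppro G ω P) (i : ℕ) : Memory :=
  (Finset.univ.filter fun t : (Fin n × Fin n) × (Fin n × Fin n) × Fin n =>
      D.IsBranching t.1 t.2.1 t.2.2).image fun t =>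
    ⟨[3, i, t.1.1, t.1.2, t.2.1.1, t.2.1.2, t.2.2],
      [code (predIn (D.path t.1) t.2.2), code (succIn (D.path t.1) t.2.2),
        code (predIn (D.path t.2.1) t.2.2), code (succIn (D.path t.2.1) t.2.2)],
      [edgeWt G ω t.2.2 (predIn (D.path t.1) t.2.2), edgeWt G ω t.2.2 (succIn (D.path t.1) t.2.2),
        edgeWt G ω t.2.2 (predIn (D.path t.2.1) t.2.2),
        edgeWt G ω t.2.2 (succIn (D.path t.2.1) t.2.2)]⟩

/-- Everything that the oracle stores. -/
noncomputable def Oracle.memory {h : ℕ} {L : ℕ → Set (Fin n)} (O : Oracle G ω h L) : Memory :=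
  (Finset.Icc 1 h).biUnion fun i =>
    (O.forest i).table i ∪ (O.dppro i).pairTable i ∪ (O.dppro i).homeTable i ∪
      (O.dppro i).branchTable i

end Tables

/-! ### The machine

A random access machine with finitely many integer registers and finitely many weight registers, a
stack as its working memory, a write-only output tape, and read access to the hash tables. -/

/-- Integer registers. -/
inductive Reg
  | u | v | lev | par | prev | cur | nxt | a | b | p | q | junk | found | done
  deriving DecidableEq

/-- Weight registers. -/
inductive WReg
  | total | w1 | w2 | w3 | w4
  deriving DecidableEq

/-- Tests that a program can branch on. -/
inductive Cond
  | eq (x y : Reg)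
  | ne (x y : Reg)
  | isZero (x : Reg)
  | stackNonempty

/-- Programs. -/
inductive Cmd
  | skip
  | const (x : Reg) (k : ℕ)
  | copy (x y : Reg)
  | incr (x : Reg)
  | addWt (x y : WReg)
  | read (table : ℕ) (key : List Reg) (dst : List Reg) (wdst : List WReg)
  | emit (x : Reg)
  | push (x : Reg)
  | pop (x : Reg)
  | seq (c d : Cmd)
  | ite (b : Cond) (c d : Cmd)
  | while (b : Cond) (c : Cmd)

/-- Sequential composition of a list of programs. -/
def Cmd.block : List Cmd → Cmd
  | [] => Cmd.skip
  | c :: cs => Cmd.seq c (Cmd.block cs)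

/-- The state of the machine. -/
structure State where
  reg : Reg → ℕ
  wreg : WReg → ℝ≥0
  stack : List ℕ
  out : List ℕ

/-- The value of a test. -/
def Cond.Holds : Cond → State → Prop
  | .eq x y, s => s.reg x = s.reg y
  | .ne x y, s => s.reg x ≠ s.reg y
  | .isZero x, s => s.reg x = 0
  | .stackNonempty, s => s.stack ≠ []

/-- Assign a list of values to a list of registers. -/
def assign {α β : Type} [DecidableEq α] (f : α → β) : List α → List β → α → β
  | x :: xs, y :: ys => assign (Function.update f x y) xs ys
  | _, _ => f

/-- `Exec M c s t s'`: with the hash tables `M`, the program `c`, started in the state `s`, halts in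
the state `s'` after `t` steps. Every elementary instruction and every test is one step, and a
lookup costs one step for each word of the key and each word fetched, in addition. -/
inductive Exec (M : Memory) : Cmd → State → ℕ → State → Prop
  | skip (s : State) : Exec M .skip s 1 s
  | const (s : State) (x : Reg) (k : ℕ) :
      Exec M (.const x k) s 1 { s with reg := Function.update s.reg x k }
  | copy (s : State) (x y : Reg) :
      Exec M (.copy x y) s 1 { s with reg := Function.update s.reg x (s.reg y) }
  | incr (s : State) (x : Reg) :
      Exec M (.incr x) s 1 { s with reg := Function.update s.reg x (s.reg x + 1) }
  | addWt (s : State) (x y : WReg) :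
      Exec M (.addWt x y) s 1 { s with wreg := Function.update s.wreg x (s.wreg x + s.wreg y) }
  | read_found (s : State) (i : ℕ) (key dst : List Reg) (wdst : List WReg) (e : Entry)
      (he : M.lookup (i :: key.map s.reg) = some e) :
      Exec M (.read i key dst wdst) s (2 + key.length + dst.length + wdst.length)
        { s with
          reg := Function.update (assign s.reg dst e.ids) .found 1
          wreg := assign s.wreg wdst e.wts }
  | read_absent (s : State) (i : ℕ) (key dst : List Reg) (wdst : List WReg)
      (he : M.lookup (i :: key.map s.reg) = none) :
      Exec M (.read i key dst wdst) s (2 + key.length + dst.length + wdst.length)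
        { s with reg := Function.update s.reg .found 0 }
  | emit (s : State) (x : Reg) : Exec M (.emit x) s 1 { s with out := s.out ++ [s.reg x] }
  | push (s : State) (x : Reg) : Exec M (.push x) s 1 { s with stack := s.reg x :: s.stack }
  | pop (s : State) (x : Reg) (k : ℕ) (st : List ℕ) (hs : s.stack = k :: st) :
      Exec M (.pop x) s 1 { s with reg := Function.update s.reg x k, stack := st }
  | seq {s s₁ s₂ : State} {c d : Cmd} {t₁ t₂ : ℕ} (hc : Exec M c s t₁ s₁)
      (hd : Exec M d s₁ t₂ s₂) : Exec M (.seq c d) s (t₁ + t₂) s₂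
  | ite_true {s s₁ : State} {b : Cond} {c d : Cmd} {t : ℕ} (hb : b.Holds s)
      (hc : Exec M c s t s₁) : Exec M (.ite b c d) s (1 + t) s₁
  | ite_false {s s₁ : State} {b : Cond} {c d : Cmd} {t : ℕ} (hb : ¬ b.Holds s)
      (hd : Exec M d s t s₁) : Exec M (.ite b c d) s (1 + t) s₁
  | while_true {s s₁ s₂ : State} {b : Cond} {c : Cmd} {t₁ t₂ : ℕ} (hb : b.Holds s)
      (hc : Exec M c s t₁ s₁) (hw : Exec M (.while b c) s₁ t₂ s₂) :
      Exec M (.while b c) s (1 + t₁ + t₂) s₂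
  | while_false {s : State} {b : Cond} {c : Cmd} (hb : ¬ b.Holds s) : Exec M (.while b c) s 1 s

/-! ### The query algorithm -/

/-- Move `u` to the root of its tree on the level `lev`, reporting the vertices on the way. -/
def climbU : Cmd :=
  .block
    [.read 0 [.lev, .u] [.par] [.w1],
     .while (.ne .par .u) (.block
       [.copy .u .par,
        .addWt .total .w1,
        .emit .u,
        .read 0 [.lev, .u] [.par] [.w1]])]

/-- Move `v` to the root of its tree on the level `lev`. The vertices on the way are put on the
stack, since the path that is reported traverses them in the opposite order. -/
def climbV : Cmd :=
  .block
    [.read 0 [.lev, .v] [.par] [.w1],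
     .while (.ne .par .v) (.block
       [.push .v,
        .copy .v .par,
        .addWt .total .w1,
        .read 0 [.lev, .v] [.par] [.w1]])]

/-- Report the stored path of the pair `(u, v)` on the level `lev`; its first edge, to the vertex
`nxt` and of weight `w1`, has been fetched already. At an internal vertex `cur` of the path, the
next edge is fetched from the record of the branching event with the home path of `cur`; if there is
no such event, then it is the edge of the home path that does not lead back. -/
def followPath : Cmd :=
  .block
    [.copy .prev .u,
     .copy .cur .nxt,
     .addWt .total .w1,
     .emit .cur,
     .while (.ne .cur .v) (.block
       [.read 2 [.lev, .cur] [.p, .q, .a, .b] [.w1, .w2],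
        .ite (.eq .a .prev)
          (.block [.copy .nxt .b, .read 3 [.lev, .p, .q, .u, .v, .cur]
            [.junk, .junk, .junk, .nxt] [.w1, .w1, .w1, .w2], .addWt .total .w2])
          (.block [.copy .nxt .a, .read 3 [.lev, .p, .q, .u, .v, .cur]
            [.junk, .junk, .junk, .nxt] [.w2, .w2, .w2, .w1], .addWt .total .w1]),
        .copy .prev .cur,
        .copy .cur .nxt,
        .emit .cur])]

/-- The query algorithm. It starts on level 1 with the queried vertices themselves, and for
`lev = 1, 2, …` reports the stored path if `(u, v)` belongs to `P_lev`, and otherwise replaces `u`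
and `v` by their closest landmarks on the next level. (If there is no landmark there to be reached,
it gives up; this concerns only vertices that are not connected to each other.) -/
def query : Cmd :=
  .block
    [.emit .u,
     .const .lev 1,
     .const .done 0,
     .while (.isZero .done)
       (.ite (.eq .u .v)
         (.const .done 1)
         (.block
           [.read 1 [.lev, .u, .v] [.nxt, .junk] [.w1, .w2],
            .ite (.isZero .found)
              (.block
                [.incr .lev,
                 .read 0 [.lev, .u] [.par] [.w1],
                 .ite (.isZero .found) (.const .done 2) (.block
                   [.read 0 [.lev, .v] [.par] [.w1],
                    .ite (.isZero .found) (.const .done 2) (.block [climbU, climbV])])])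
              (.block [followPath, .const .done 1])])),
     .while .stackNonempty (.block [.pop .junk, .emit .junk])]

/-- The initial state of a query: the names of the two vertices are in the registers `u` and `v`. -/
def initState {n : ℕ} (u v : Fin n) : State where
  reg := fun
    | .u => u
    | .v => v
    | _ => 0
  wreg := fun _ => 0
  stack := []
  out := []

/-- With access to nothing but the memory `M` and the names of `u` and `v`, the query algorithm
halts after `t` steps, having reported the walk `p` of `G` from `u` to `v` on the output tape, and
its length in the register `total` as the distance estimate. -/
def Reports {n : ℕ} {G : SimpleGraph (Fin n)} (ω : Sym2 (Fin n) → ℝ≥0) (M : Memory) {u v : Fin n}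
    (t : ℕ) (p : G.Walk u v) : Prop :=
  ∃ s : State, Exec M query (initState u v) t s ∧
    s.out = p.support.map (fun x => (x : ℕ)) ∧ s.wreg .total = walkWeight ω p

end PathOracle

/-!
The existence of the oracle is a matter of consistent tie-breaking. For the trees, every vertex is
assigned to the smallest of its closest landmarks (`nonempty_forest`). For the paths, one takes
among all shortest walks the one with the least sum of the numbers `2 ^ (index of e)` over its edges `e`
(`IsCanonical`); it is unique, and being canonical passes to subwalks and reversals, so that any two
of these paths share what lies between two common vertices (`nonempty_dppro`).

*Space.* Two consistent paths branch at most twice, namely at the first and at the last of their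
common vertices (`Dppro.IsBranching.head_or_last`), so it suffices to count crossing pairs of paths.
If the paths of two pairs of a level cross, then for one of the four endpoints the other three are
closer to it than all landmarks of the next level (`mem_clusters_of_crossing`); such a landmark
together with three others in its ball is called a cluster. Let `p` be the sampling probability of
the level and `q` that of the next one. The number of vertices of a ball is dominated by a geometric
variable with parameter `q`, so the expected number of `k`-subsets of a ball is at most `q ^ (-k)`
(`sum_powersetCard_le`), and the expected number of clusters is `O(n p (p / q) ^ 3)`. The
probabilities are chosen such that this is `O(n)` (`mul_sampleProb_pow_le`), and the top level has
so few landmarks that the fourth power of their number is `O(n)`. As there are `h = O(log log n)`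
levels, the expected space is `O(n log log n)` (`lintegral_space_le`). If the landmark sets are made
disjoint, then the sets only shrink, and a vertex is a landmark of the next level still with
probability at least a constant times `q`, because the probabilities of the levels decay
geometrically (`le_thinnedProb`); the same estimate applies with another constant.

*Query.* If the current vertices, at distance `d`, are not a stored pair, then both of them are
within `3 d` of the next level, so that their successors have distance at most `7 d`. The reported
walk has length at most `(2 * 7 ^ (h - 1) - 1) d`, where `7 ^ (h - 1)` is polylogarithmic since
`(4 / 3) ^ (h - 1) < log₂ n + 1`. Each level costs constant time plus constant time for each edge of
the trees and paths traversed (`exec_levelLoop`). If the landmark sets are disjoint above level 1,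
then every step from one such level to the next traverses at least one edge, which pays for the
level.
-/

namespace PathOracle

/-! ### Walks and weighted distances -/

section Walks

variable {n : ℕ} {G : SimpleGraph (Fin n)} (ω : Sym2 (Fin n) → ℝ≥0)

@[simp] lemma walkWeight_nil (u : Fin n) : walkWeight ω (.nil : G.Walk u u) = 0 := by
  simp [walkWeight]

@[simp] lemma walkWeight_cons {u v w : Fin n} (h : G.Adj u v) (p : G.Walk v w) :
    walkWeight ω (.cons h p) = ω s(u, v) + walkWeight ω p := by
  simp [walkWeight]

lemma walkWeight_append {u v w : Fin n} (p : G.Walk u v) (q : G.Walk v w) :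
    walkWeight ω (p.append q) = walkWeight ω p + walkWeight ω q := by
  simp [walkWeight, SimpleGraph.Walk.edges_append]

lemma walkWeight_reverse {u v : Fin n} (p : G.Walk u v) :
    walkWeight ω p.reverse = walkWeight ω p := by
  simp [walkWeight, SimpleGraph.Walk.edges_reverse, List.sum_reverse]

lemma wdist_le_walkWeight {u v : Fin n} (p : G.Walk u v) : wdist G ω u v ≤ walkWeight ω p :=
  iInf_le _ p

lemma walkWeight_bypass_le {u v : Fin n} (p : G.Walk u v) :
    walkWeight ω p.bypass ≤ walkWeight ω p :=
  (p.edges_bypass_sublist_edges.map ω).sum_le_sum (by simp)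

/-- The infimum over all walks is attained, because it suffices to consider the finitely many
paths. -/
lemma exists_walk_eq_wdist {u v : Fin n} (h : G.Reachable u v) :
    ∃ p : G.Walk u v, (walkWeight ω p : ℝ≥0∞) = wdist G ω u v := by
  classical
  obtain ⟨p₀⟩ := h
  have : Nonempty (G.Path u v) := ⟨p₀.toPath⟩
  obtain ⟨q, hq⟩ := Finite.exists_min fun p : G.Path u v => walkWeight ω p.1
  refine ⟨q.1, le_antisymm (le_iInf fun p => ?_) (wdist_le_walkWeight ω q.1)⟩
  exact_mod_cast (hq p.toPath).trans (walkWeight_bypass_le ω p)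

lemma wdist_ne_top_iff {u v : Fin n} : wdist G ω u v ≠ ⊤ ↔ G.Reachable u v := by
  constructor
  · intro h
    by_contra hr
    have : IsEmpty (G.Walk u v) := not_nonempty_iff.1 hr
    exact h (by simp [wdist])
  · intro h
    obtain ⟨p, hp⟩ := exists_walk_eq_wdist ω h
    simp [← hp]

@[simp] lemma wdist_self (u : Fin n) : wdist G ω u u = 0 := by
  simpa using wdist_le_walkWeight ω (.nil : G.Walk u u)

lemma wdist_le_wdist_symm (u v : Fin n) : wdist G ω u v ≤ wdist G ω v u :=
  le_iInf fun p => by simpa [walkWeight_reverse] using wdist_le_walkWeight ω p.reverse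

lemma wdist_comm (u v : Fin n) : wdist G ω u v = wdist G ω v u :=
  le_antisymm (wdist_le_wdist_symm ω u v) (wdist_le_wdist_symm ω v u)

lemma wdist_triangle (u v w : Fin n) : wdist G ω u w ≤ wdist G ω u v + wdist G ω v w := by
  by_cases h₁ : G.Reachable u v
  · by_cases h₂ : G.Reachable v w
    · obtain ⟨p, hp⟩ := exists_walk_eq_wdist ω h₁
      obtain ⟨q, hq⟩ := exists_walk_eq_wdist ω h₂
      rw [← hp, ← hq]
      exact (wdist_le_walkWeight ω (p.append q)).trans_eq (by
        rw [walkWeight_append, ENNReal.coe_add])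
    · simp [not_not.1 (mt (wdist_ne_top_iff ω).1 h₂)]
  · simp [not_not.1 (mt (wdist_ne_top_iff ω).1 h₁)]

lemma wdist_le_adj_add {u v : Fin n} (h : G.Adj u v) (w : Fin n) :
    wdist G ω u w ≤ ω s(u, v) + wdist G ω v w := by
  refine (wdist_triangle ω u v w).trans (add_le_add_left ?_ _)
  simpa using wdist_le_walkWeight ω (SimpleGraph.Walk.cons h .nil)

variable {ω}

/-- What follows the first edge of a shortest walk is a shortest walk, and the distances add up. -/
lemma wdist_cons_of_shortest {u v w : Fin n} {h : G.Adj u v} {p : G.Walk v w}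
    (hp : (walkWeight ω (.cons h p) : ℝ≥0∞) = wdist G ω u w) :
    wdist G ω u w = ω s(u, v) + wdist G ω v w ∧ (walkWeight ω p : ℝ≥0∞) = wdist G ω v w := by
  have h₁ := wdist_le_adj_add ω h w
  have h₂ := wdist_le_walkWeight ω p
  have h₃ : (ω s(u, v) : ℝ≥0∞) + walkWeight ω p = wdist G ω u w := by
    rw [← hp, walkWeight_cons]; push_cast; rfl
  refine ⟨le_antisymm h₁ (h₃ ▸ add_le_add_right h₂ _), le_antisymm ?_ h₂⟩
  rw [← h₃] at h₁
  exact (ENNReal.add_le_add_iff_left ENNReal.coe_ne_top).1 h₁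

/-! ### Closest landmarks and shortest path forests -/

lemma radius_le {A : Set (Fin n)} {l : Fin n} (hl : l ∈ A) (v : Fin n) :
    radius G ω A v ≤ wdist G ω v l :=
  iInf₂_le l hl

lemma exists_closest {A : Set (Fin n)} {v : Fin n} (h : radius G ω A v ≠ ⊤) :
    ∃ l ∈ A, wdist G ω v l = radius G ω A v := by
  have hA : A.Nonempty := by
    by_contra hA
    simp [radius, Set.not_nonempty_iff_eq_empty.1 hA] at h
  obtain ⟨l, hl, hmin⟩ := Set.exists_min_image A (wdist G ω v) A.toFinite hA
  exact ⟨l, hl, le_antisymm (le_iInf₂ hmin) (radius_le hl v)⟩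

lemma radius_le_adj_add (A : Set (Fin n)) {u v : Fin n} (h : G.Adj u v) :
    radius G ω A u ≤ ω s(u, v) + radius G ω A v := by
  by_cases hv : radius G ω A v = ⊤
  · simp [hv]
  · obtain ⟨l, hl, hd⟩ := exists_closest hv
    rw [← hd]
    exact (radius_le hl u).trans (wdist_le_adj_add ω h l)

/-- Shortest path forests exist: every vertex is assigned to the first one of its closest landmarks,
and its parent is the next vertex of a shortest path to that landmark. The rule for ties makes the
parent belong to the same tree. -/
lemma nonempty_forest (A : Set (Fin n)) :
    Nonempty (Forest G ω A) := by
  classical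
  have hnear : ∀ v, ∃ l : Fin n, radius G ω A v ≠ ⊤ → l ∈ A ∧ wdist G ω v l = radius G ω A v ∧
      ∀ l' ∈ A, wdist G ω v l' = radius G ω A v → l ≤ l' := by
    intro v
    by_cases hv : radius G ω A v = ⊤
    · exact ⟨v, fun h => absurd hv h⟩
    · obtain ⟨l, hl, hd⟩ := exists_closest hv
      obtain ⟨m, hm, hmin⟩ := Set.exists_min_image
        {l | l ∈ A ∧ wdist G ω v l = radius G ω A v} id (Set.toFinite _) ⟨l, hl, hd⟩
      exact ⟨m, fun _ => ⟨hm.1, hm.2, fun l' h₁ h₂ => hmin l' ⟨h₁, h₂⟩⟩⟩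
  choose near hn using hnear
  have hpar : ∀ v, ∃ w : Fin n, radius G ω A v ≠ ⊤ →
      (near v = v → w = v) ∧ (near v ≠ v → G.Adj v w ∧
        wdist G ω v (near v) = ω s(v, w) + wdist G ω w (near v)) := by
    intro v
    by_cases hv : radius G ω A v = ⊤
    · exact ⟨v, fun h => absurd hv h⟩
    by_cases hne : near v = v
    · exact ⟨v, fun _ => ⟨fun _ => rfl, fun h => absurd hne h⟩⟩
    · have hr : G.Reachable v (near v) := (wdist_ne_top_iff ω).1 (by rwa [(hn v hv).2.1])
      obtain ⟨p, hp⟩ := exists_walk_eq_wdist ω hr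
      generalize near v = l at *
      cases p with
      | nil => exact absurd rfl hne
      | @cons _ w _ ha q =>
        exact ⟨w, fun _ => ⟨fun h => absurd h hne, fun _ => ⟨ha, (wdist_cons_of_shortest hp).1⟩⟩⟩
  choose parent hp using hpar
  refine ⟨⟨near, parent, fun v hv => (hn v hv).1, fun v hv => (hn v hv).2.1,
    fun v hv => (hp v hv).1, fun v hv h => ((hp v hv).2 h).1, fun v hv h => ?_,
    fun v hv h => ((hp v hv).2 h).2⟩⟩
  obtain ⟨ha, hd⟩ := (hp v hv).2 h
  obtain ⟨hA, hcl, hmin⟩ := hn v hv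
  have hle := radius_le_adj_add (ω := ω) A ha
  have hr : wdist G ω (parent v) (near v) = radius G ω A (parent v) := by
    refine le_antisymm ?_ (radius_le hA _)
    rw [← hcl, hd] at hle
    exact (ENNReal.add_le_add_iff_left ENNReal.coe_ne_top).1 hle
  have hfin : radius G ω A (parent v) ≠ ⊤ := by
    rw [← hr]; intro htop; rw [htop] at hd; exact hv (by rw [← hcl, hd]; simp)
  obtain ⟨hA', hcl', hmin'⟩ := hn (parent v) hfin
  refine le_antisymm (hmin' _ hA hr) (hmin _ hA' (le_antisymm ?_ (radius_le hA' v)))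
  calc wdist G ω v (near (parent v))
      ≤ ω s(v, parent v) + wdist G ω (parent v) (near (parent v)) := wdist_le_adj_add ω ha _
    _ = radius G ω A v := by rw [hcl', ← hr, ← hd, hcl]

/-! ### Consistent shortest paths -/

/-- A shortest walk is canonical if it minimises the sum of the terms `2 ^ (index of e)` over its
edges `e`, among all shortest walks with the same endpoints. The index `τ e` breaks the ties. -/
def IsCanonical (G : SimpleGraph (Fin n)) (ω : Sym2 (Fin n) → ℝ≥0) (τ : Sym2 (Fin n) → ℕ)
    {u v : Fin n} (p : G.Walk u v) : Prop :=
  (walkWeight ω p : ℝ≥0∞) = wdist G ω u v ∧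
    ∀ q : G.Walk u v, (walkWeight ω q : ℝ≥0∞) = wdist G ω u v →
      (p.edges.map fun e => 2 ^ τ e).sum ≤ (q.edges.map fun e => 2 ^ τ e).sum

variable {τ : Sym2 (Fin n) → ℕ}

lemma exists_isCanonical {u v : Fin n} (h : G.Reachable u v) :
    ∃ p : G.Walk u v, IsCanonical G ω τ p := by
  classical
  have hne : {p : G.Walk u v | (walkWeight ω p : ℝ≥0∞) = wdist G ω u v}.Nonempty :=
    exists_walk_eq_wdist ω h
  refine ⟨Function.argminOn (fun p : G.Walk u v => (p.edges.map fun e => 2 ^ τ e).sum) _ hne,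
    Function.argminOn_mem _ _ hne, fun q hq => ?_⟩
  exact Function.argminOn_le (fun p : G.Walk u v => (p.edges.map fun e => 2 ^ τ e).sum)
    {p : G.Walk u v | (walkWeight ω p : ℝ≥0∞) = wdist G ω u v} hq

lemma IsCanonical.reverse {u v : Fin n} {p : G.Walk u v} (h : IsCanonical G ω τ p) :
    IsCanonical G ω τ p.reverse := by
  refine ⟨by rw [walkWeight_reverse, h.1, wdist_comm], fun q hq => ?_⟩
  have := h.2 q.reverse (by rw [walkWeight_reverse, hq, wdist_comm])
  simpa [List.sum_reverse] using this

/-- A subwalk of a canonical walk is canonical, since a better one could replace it. -/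
lemma IsCanonical.of_append {u v w x : Fin n} {p : G.Walk u v} {q : G.Walk v w} {r : G.Walk w x}
    (h : IsCanonical G ω τ ((p.append q).append r)) : IsCanonical G ω τ q := by
  have key : ∀ q' : G.Walk v w, walkWeight ω q ≤ walkWeight ω q' := fun q' => by
    have := h.1.trans_le (wdist_le_walkWeight ω ((p.append q').append r))
    rw [ENNReal.coe_le_coe] at this
    simpa [walkWeight_append] using this
  have hq : (walkWeight ω q : ℝ≥0∞) = wdist G ω v w :=
    le_antisymm (le_iInf fun q' => by exact_mod_cast key q') (wdist_le_walkWeight ω q)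
  refine ⟨hq, fun q' hq' => ?_⟩
  have heq : walkWeight ω q' = walkWeight ω q := by exact_mod_cast hq'.trans hq.symm
  have := h.2 ((p.append q').append r) (by
    rw [← h.1]; simp only [walkWeight_append, heq])
  simpa [SimpleGraph.Walk.edges_append] using this

lemma isPath_of_shortest (hω : ∀ e ∈ G.edgeSet, 0 < ω e) {u v : Fin n} {p : G.Walk u v}
    (h : (walkWeight ω p : ℝ≥0∞) = wdist G ω u v) : p.IsPath := by
  classical
  induction p with
  | nil => simp
  | @cons u v w ha p ih =>
    have hs := wdist_cons_of_shortest h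
    refine (SimpleGraph.Walk.cons_isPath_iff ha p).2 ⟨ih hs.2, fun hu => ?_⟩
    have h₁ := wdist_le_walkWeight ω (p.dropUntil u hu)
    have h₂ : walkWeight ω (p.dropUntil u hu) ≤ walkWeight ω p := by
      rw [← congrArg (walkWeight ω) (p.take_spec hu), walkWeight_append]
      exact le_add_self
    rw [← h, ENNReal.coe_le_coe, walkWeight_cons] at h₁
    exact absurd (h₁.trans h₂) (not_le.2 (lt_add_of_pos_left _ (hω s(u, v) ha)))

/-- There is only one canonical walk between two vertices: equal sums of distinct powers of two have
the same terms, and the edges of a path determine the path. -/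
lemma IsCanonical.eq (hω : ∀ e ∈ G.edgeSet, 0 < ω e) (hτ : Function.Injective τ) {u v : Fin n}
    {p q : G.Walk u v} (hp : IsCanonical G ω τ p) (hq : IsCanonical G ω τ q) : p = q := by
  classical
  have hedges : ∀ e, e ∈ p.edges ↔ e ∈ q.edges := by
    have hsum := le_antisymm (hp.2 q hq.1) (hq.2 p hp.1)
    have hform : ∀ {r : G.Walk u v}, (walkWeight ω r : ℝ≥0∞) = wdist G ω u v →
        (r.edges.map fun e => 2 ^ τ e).sum =
          ∑ i ∈ (r.edges.map τ).toFinset, 2 ^ i := fun {r} hr => by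
      rw [List.sum_toFinset _ ((isPath_of_shortest hω hr).isTrail.edges_nodup.map hτ), List.map_map]
      rfl
    rw [hform hp.1, hform hq.1] at hsum
    have := Finset.geomSum_injective le_rfl hsum
    intro e
    have he := Finset.ext_iff.1 this (τ e)
    simpa [hτ.eq_iff] using he
  have hpp := isPath_of_shortest hω hp.1
  have hqp := isPath_of_shortest hω hq.1
  clear hp hq
  induction p with
  | nil => exact (SimpleGraph.Walk.isPath_iff_nil.1 hqp).eq_nil.symm
  | @cons u v w ha p ih =>
    cases q with
    | nil => exact absurd hpp (by simp)
    | @cons _ v' _ ha' q =>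
      rw [SimpleGraph.Walk.cons_isPath_iff] at hpp hqp
      have hp' : ∀ x, s(u, x) ∉ p.edges := fun x hx =>
        hpp.2 (p.fst_mem_support_of_mem_edges hx)
      have hq' : ∀ x, s(u, x) ∉ q.edges := fun x hx =>
        hqp.2 (q.fst_mem_support_of_mem_edges hx)
      obtain rfl : v = v' := by
        have := (hedges s(u, v)).1 (by simp)
        simp only [SimpleGraph.Walk.edges_cons, List.mem_cons, hq', or_false] at this
        exact Sym2.congr_right.1 this
      congr 1
      refine ih (fun e => ?_) hpp.1 hqp.1
      have he := hedges e
      simp only [SimpleGraph.Walk.edges_cons, List.mem_cons] at he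
      by_cases h : e = s(u, v)
      · subst h; simp [hp', hq']
      · simpa [h] using he

/-- Consistent shortest paths exist: the canonical walks are determined by their endpoints, and the
class of canonical walks is closed under reversal and under taking subwalks. -/
lemma nonempty_dppro (hω : ∀ e ∈ G.edgeSet, 0 < ω e) {P : Set (Fin n × Fin n)}
    (hP : ∀ a ∈ P, G.Reachable a.1 a.2) : Nonempty (Dppro G ω P) := by
  classical
  obtain ⟨τ, hτ⟩ := exists_injective_nat (Sym2 (Fin n))
  have hw : ∀ a : Fin n × Fin n, ∃ l : List (Fin n), a ∈ P →
      ∃ w : G.Walk a.1 a.2, w.support = l ∧ IsCanonical G ω τ w := by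
    intro a
    by_cases ha : a ∈ P
    · obtain ⟨w, hw⟩ := exists_isCanonical (ω := ω) (τ := τ) (hP a ha)
      exact ⟨w.support, fun _ => ⟨w, rfl, hw⟩⟩
    · exact ⟨[], fun h => absurd h ha⟩
  choose path hpath using hw
  have hh : ∀ x : Fin n, ∃ b : Fin n × Fin n, (∃ a ∈ P, x ∈ path a ∧ x ≠ a.1 ∧ x ≠ a.2) →
      b ∈ P ∧ x ∈ path b ∧ x ≠ b.1 ∧ x ≠ b.2 := fun x => by
    by_cases h : ∃ a ∈ P, x ∈ path a ∧ x ≠ a.1 ∧ x ≠ a.2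
    · exact ⟨h.choose, fun _ => h.choose_spec⟩
    · exact ⟨(x, x), fun h' => absurd h' h⟩
  choose home hhome using hh
  have hsub : ∀ a ∈ P, ∀ (x y : Fin n) (m : List (Fin n)), x :: (m ++ [y]) <:+: path a →
      ∃ w : G.Walk x y, w.support = x :: (m ++ [y]) ∧ IsCanonical G ω τ w := by
    intro a ha x y m hm
    obtain ⟨w, hws, hwc⟩ := hpath a ha
    rw [← hws] at hm
    have hchain : (x :: (m ++ [y])).IsChain G.Adj := w.isChain_adj_support.infix hm
    have hsup := SimpleGraph.Walk.support_ofSupport (by simp) hchain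
    have hx : (x :: (m ++ [y])).head (by simp) = x := by simp
    have hy : (x :: (m ++ [y])).getLast (by simp) = y := by simp
    set r := (SimpleGraph.Walk.ofSupport _ (by simp) hchain).copy hx hy with hr
    have hrs : r.support = x :: (m ++ [y]) := by rw [hr, SimpleGraph.Walk.support_copy, hsup]
    refine ⟨r, hrs, ?_⟩
    obtain ⟨p, q, hpq⟩ : r.IsSubwalk w := by
      rw [SimpleGraph.Walk.isSubwalk_iff_support_isInfix, hrs]; exact hm
    rw [hpq] at hwc
    exact hwc.of_append
  refine ⟨⟨path, home, fun a ha => ?_, fun a ha ha' => ?_, ?_, hhome⟩⟩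
  · obtain ⟨w, hws, hwc⟩ := hpath a ha
    exact ⟨w, hws, hwc.1⟩
  · obtain ⟨w, hws, hwc⟩ := hpath a ha
    obtain ⟨w', hws', hwc'⟩ := hpath a.swap ha'
    rw [← hws, ← hws', ← SimpleGraph.Walk.support_reverse]
    exact congrArg _ (hwc'.eq hω hτ hwc.reverse)
  · intro a ha b hb x y m m' hm hm'
    obtain ⟨w, hws, hwc⟩ := hsub a ha x y m hm
    obtain ⟨w', hws', hwc'⟩ := hsub b hb x y m' hm'
    rw [hwc.eq hω hτ hwc'] at hws
    simpa using hws.symm.trans hws'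

end Walks

/-! ### The landmark pairs -/

section Pairs

variable {n : ℕ} {G : SimpleGraph (Fin n)} {ω : Sym2 (Fin n) → ℝ≥0} {h : ℕ} {L : ℕ → Set (Fin n)}
  {i : ℕ}

lemma reachable_of_mem_fractionBall {c : ℝ≥0∞} {A : Set (Fin n)} {u x : Fin n}
    (hx : x ∈ fractionBall G ω c A u) : G.Reachable u x :=
  (wdist_ne_top_iff ω).1 (lt_top_of_lt hx).ne

lemma landmarkPairs_reachable {a : Fin n × Fin n} (ha : a ∈ landmarkPairs G ω h L i) :
    G.Reachable a.1 a.2 := by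
  obtain ⟨-, -, -, h⟩ := ha
  split_ifs at h
  · exact h.elim reachable_of_mem_fractionBall fun h => (reachable_of_mem_fractionBall h).symm
  · exact h

lemma landmarkPairs_swap {a : Fin n × Fin n} (ha : a ∈ landmarkPairs G ω h L i) :
    a.swap ∈ landmarkPairs G ω h L i := by
  obtain ⟨h₁, h₂, h₃, h₄⟩ := ha
  refine ⟨h₁.symm, h₃, h₂, ?_⟩
  split_ifs at h₄ ⊢
  · exact h₄.symm
  · exact h₄.symm

lemma nonempty_oracle (hω : ∀ e ∈ G.edgeSet, 0 < ω e) (h : ℕ) (L : ℕ → Set (Fin n)) :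
    Nonempty (Oracle G ω h L) :=
  ⟨⟨fun i => (nonempty_forest (L i)).some,
    fun _ => (nonempty_dppro hω fun _ ha => landmarkPairs_reachable ha).some⟩⟩

end Pairs

/-! ### Neighbours in a path -/

section Lists

variable {n : ℕ}

lemma predIn_append_cons {s t : List (Fin n)} {x : Fin n} (hx : x ∉ s) :
    predIn (s ++ x :: t) x = s.getLast? := by
  have h : (s ++ x :: t).idxOf x = s.length := by
    rw [List.idxOf_append_of_notMem hx]; simp
  rw [predIn, h]
  rcases List.eq_nil_or_concat s with rfl | ⟨s', y, rfl⟩ <;> simp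

lemma succIn_append_cons {s t : List (Fin n)} {x : Fin n} (hx : x ∉ s) :
    succIn (s ++ x :: t) x = t.head? := by
  have h : (s ++ x :: t).idxOf x = s.length := by
    rw [List.idxOf_append_of_notMem hx]; simp
  rw [succIn, h]
  cases t <;> simp

lemma predIn_reverse {l : List (Fin n)} (hl : l.Nodup) {x : Fin n} (hx : x ∈ l) :
    predIn l.reverse x = succIn l x := by
  obtain ⟨s, t, rfl⟩ := List.append_of_mem hx
  have hl' := List.nodup_append.1 hl
  have h₁ : x ∉ s := fun h => hl'.2.2 x h x (by simp) rfl
  have h₂ : x ∉ t := (List.nodup_cons.1 hl'.2.1).1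
  have hr : (s ++ x :: t).reverse = t.reverse ++ x :: s.reverse := by simp
  rw [hr, predIn_append_cons (by simpa using h₂), succIn_append_cons h₁]
  simp

lemma succIn_reverse {l : List (Fin n)} (hl : l.Nodup) {x : Fin n} (hx : x ∈ l) :
    succIn l.reverse x = predIn l x := by
  have := predIn_reverse (List.nodup_reverse.2 hl) (List.mem_reverse.2 hx)
  rw [List.reverse_reverse] at this
  exact this.symm

end Lists

/-! ### Branching events -/

section Branching

variable {n : ℕ} {G : SimpleGraph (Fin n)} {ω : Sym2 (Fin n) → ℝ≥0} {P : Set (Fin n × Fin n)}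

lemma Dppro.nodup_path (hω : ∀ e ∈ G.edgeSet, 0 < ω e) (D : Dppro G ω P) {a : Fin n × Fin n}
    (ha : a ∈ P) : (D.path a).Nodup := by
  obtain ⟨w, hw, hd⟩ := D.path_shortest a ha
  exact hw ▸ (isPath_of_shortest hω hd).support_nodup

/-- The vertices strictly between two vertices which two paths traverse in the same order have the
same neighbours in both paths. -/
lemma Dppro.eq_of_between (D : Dppro G ω P) {a b : Fin n × Fin n} (ha : a ∈ P) (hb : b ∈ P)
    (hna : (D.path a).Nodup) (hnb : (D.path b).Nodup) {x y z : Fin n}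
    {s m₁ m₂ t s' m' t' : List (Fin n)}
    (h : D.path a = s ++ y :: (m₁ ++ x :: (m₂ ++ z :: t)))
    (h' : D.path b = s' ++ y :: (m' ++ z :: t')) :
    predIn (D.path a) x = predIn (D.path b) x ∧ succIn (D.path a) x = succIn (D.path b) x := by
  have hm : m₁ ++ x :: m₂ = m' := by
    refine D.path_consistent a ha b hb y z _ _ ⟨s, t, ?_⟩ ⟨s', t', ?_⟩
    · rw [h]; simp
    · rw [h']; simp
  subst hm
  have e₁ : D.path a = (s ++ y :: m₁) ++ x :: (m₂ ++ z :: t) := by rw [h]; simp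
  have e₂ : D.path b = (s' ++ y :: m₁) ++ x :: (m₂ ++ z :: t') := by rw [h']; simp
  have n₁ : x ∉ s ++ y :: m₁ := fun hx => by
    rw [e₁] at hna; exact (List.nodup_append.1 hna).2.2 x hx x (by simp) rfl
  have n₂ : x ∉ s' ++ y :: m₁ := fun hx => by
    rw [e₂] at hnb; exact (List.nodup_append.1 hnb).2.2 x hx x (by simp) rfl
  rw [e₁, e₂, predIn_append_cons n₁, predIn_append_cons n₂, succIn_append_cons n₁,
    succIn_append_cons n₂]
  constructor
  · simp [List.getLast?_append, List.getLast?_cons]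
  · cases m₂ <;> simp

/-- The common vertices of two consistent paths are consecutive on both of them, so that the paths
can branch only at the first or at the last common vertex. -/
lemma Dppro.IsBranching.head_or_last (hω : ∀ e ∈ G.edgeSet, 0 < ω e) (hP : ∀ a ∈ P, a.swap ∈ P)
    {D : Dppro G ω P} {a b : Fin n × Fin n} {x : Fin n} (hbr : D.IsBranching a b x) :
    ((D.path a).filter (· ∈ D.path b)).head? = some x ∨
      ((D.path a).filter (· ∈ D.path b)).getLast? = some x := by
  obtain ⟨ha, hb, -, hxa, hxb, hne⟩ := hbr
  have hna := D.nodup_path hω ha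
  have hnb := D.nodup_path hω hb
  obtain ⟨s, t, hst⟩ := List.append_of_mem hxa
  by_cases h₁ : ∃ y ∈ s, y ∈ D.path b
  swap
  · left
    push Not at h₁
    rw [hst, List.filter_append, List.filter_eq_nil_iff.2 (by simpa using h₁)]
    simp [hxb]
  by_cases h₂ : ∃ z ∈ t, z ∈ D.path b
  swap
  · right
    push Not at h₂
    rw [hst, List.filter_append, List.filter_cons_of_pos (by simpa using hxb),
      (List.filter_eq_nil_iff (l := t)).2 (by simpa using h₂)]
    simp
  exfalso
  apply hne
  obtain ⟨y, hys, hyb⟩ := h₁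
  obtain ⟨z, hzt, hzb⟩ := h₂
  obtain ⟨s₁, s₂, rfl⟩ := List.append_of_mem hys
  obtain ⟨t₁, t₂, rfl⟩ := List.append_of_mem hzt
  have hst' : D.path a = s₁ ++ y :: (s₂ ++ x :: (t₁ ++ z :: t₂)) := by rw [hst]; simp
  obtain ⟨b₁, b₂, hb₁⟩ := List.append_of_mem hyb
  have hyz : y ≠ z := by
    rintro rfl
    rw [hst] at hna
    exact (List.nodup_append.1 hna).2.2 y (by simp) y (by simp) rfl
  rw [hb₁] at hzb
  rcases List.mem_append.1 hzb with hz | hz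
  · -- the path of `b` traverses `z` first, so it is compared in reverse
    obtain ⟨c₁, c₂, rfl⟩ := List.append_of_mem hz
    have hrev : D.path b.swap = b₂.reverse ++ y :: (c₂.reverse ++ z :: c₁.reverse) := by
      rw [D.path_swap b hb (hP b hb), hb₁]; simp
    obtain ⟨e₁, e₂⟩ := D.eq_of_between ha (hP b hb) hna (D.nodup_path hω (hP b hb)) hst' hrev
    rw [D.path_swap b hb (hP b hb), predIn_reverse hnb hxb] at e₁
    rw [D.path_swap b hb (hP b hb), succIn_reverse hnb hxb] at e₂
    rw [e₁, e₂, Sym2.eq_swap]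
  · have hz' : z ∈ b₂ := by simpa [hyz.symm] using hz
    obtain ⟨c₁, c₂, rfl⟩ := List.append_of_mem hz'
    obtain ⟨e₁, e₂⟩ := D.eq_of_between ha hb hna hnb hst' hb₁
    rw [e₁, e₂]

open Classical in
/-- The pairs of paths that have a common vertex. -/
noncomputable def Dppro.crossings (D : Dppro G ω P) :
    Finset ((Fin n × Fin n) × (Fin n × Fin n)) :=
  Finset.univ.filter fun c => c.1 ∈ P ∧ c.2 ∈ P ∧ ∃ x, x ∈ D.path c.1 ∧ x ∈ D.path c.2

open Classical in
/-- At most two branching events belong to a crossing pair of paths: the vertex is determined by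
whether it is the first common vertex. -/
lemma Dppro.card_branching_le (hω : ∀ e ∈ G.edgeSet, 0 < ω e) (hP : ∀ a ∈ P, a.swap ∈ P)
    (D : Dppro G ω P) :
    (Finset.univ.filter fun t : (Fin n × Fin n) × (Fin n × Fin n) × Fin n =>
      D.IsBranching t.1 t.2.1 t.2.2).card ≤ 2 * D.crossings.card := by
  have : 2 * D.crossings.card = (D.crossings ×ˢ (Finset.univ : Finset Bool)).card := by
    rw [Finset.card_product, Finset.card_univ, Fintype.card_bool, mul_comm]
  rw [this]
  refine Finset.card_le_card_of_injOn (fun t => ((t.1, t.2.1),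
    decide (((D.path t.1).filter (· ∈ D.path t.2.1)).head? = some t.2.2))) ?_ ?_
  · rintro ⟨a, b, x⟩ ht
    obtain ⟨ha, hb, -, hxa, hxb, -⟩ := (Finset.mem_filter.1 ht).2
    exact Finset.mem_product.2
      ⟨Finset.mem_filter.2 ⟨Finset.mem_univ _, ha, hb, x, hxa, hxb⟩, Finset.mem_univ _⟩
  · rintro ⟨a, b, x⟩ ht ⟨a', b', x'⟩ ht' heq
    simp only [Prod.mk.injEq, decide_eq_decide] at heq
    obtain ⟨⟨rfl, rfl⟩, heq⟩ := heq
    have h₁ := ((Finset.mem_filter.1 ht).2).head_or_last hω hP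
    have h₂ := ((Finset.mem_filter.1 ht').2).head_or_last hω hP
    simp only at h₁ h₂ heq
    have : x = x' := by
      by_cases h : ((D.path a).filter (· ∈ D.path b)).head? = some x
      · exact Option.some.inj (h.symm.trans (heq.1 h))
      · exact Option.some.inj ((h₁.resolve_left h).symm.trans (h₂.resolve_left (mt heq.2 h)))
    rw [this]

open Classical in
/-- Every path crosses itself. -/
lemma Dppro.card_pairs_le (D : Dppro G ω P) :
    (Finset.univ.filter fun a => a ∈ P).card ≤ D.crossings.card := by
  refine Finset.card_le_card_of_injOn (fun a => (a, a)) ?_ ?_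
  · intro a ha
    have ha' : a ∈ P := by simpa using ha
    obtain ⟨w, hw, -⟩ := D.path_shortest a ha'
    simpa [crossings, ha'] using ⟨a.1, hw ▸ w.start_mem_support⟩
  · intro a _ b _ hab
    exact (Prod.mk.inj hab).1

end Branching

/-! ### Crossing paths lie in common balls -/

section Clusters

variable {n : ℕ} {G : SimpleGraph (Fin n)} {ω : Sym2 (Fin n) → ℝ≥0} {h : ℕ} {L : ℕ → Set (Fin n)}
  {i : ℕ}

open Classical in
/-- A landmark together with three landmarks of the same level in its ball, that is, closer to it
than every landmark of the next level. The top level has no ball condition. -/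
noncomputable def clusters (G : SimpleGraph (Fin n)) (ω : Sym2 (Fin n) → ℝ≥0) (h : ℕ)
    (L : ℕ → Set (Fin n)) (i : ℕ) : Finset (Fin n × (Fin 3 → Fin n)) :=
  Finset.univ.filter fun c => c.1 ∈ L i ∧
    ∀ k, c.2 k ∈ L i ∧ (i < h → wdist G ω c.1 (c.2 k) < radius G ω (L (i + 1)) c.1)

lemma Dppro.wdist_le_of_mem_path {P : Set (Fin n × Fin n)} (D : Dppro G ω P) {a : Fin n × Fin n}
    (ha : a ∈ P) {z : Fin n} (hz : z ∈ D.path a) :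
    wdist G ω a.1 z ≤ wdist G ω a.1 a.2 ∧ wdist G ω z a.2 ≤ wdist G ω a.1 a.2 := by
  obtain ⟨w, hw, hd⟩ := D.path_shortest a ha
  rw [← hw] at hz
  have hsum : walkWeight ω w = walkWeight ω (w.takeUntil z hz) + walkWeight ω (w.dropUntil z hz) := by
    rw [← walkWeight_append, w.take_spec hz]
  rw [← hd, hsum]
  push_cast
  exact ⟨(wdist_le_walkWeight ω _).trans le_self_add, (wdist_le_walkWeight ω _).trans le_add_self⟩

/-- If the paths from `u` to `v` and from `x` to `y` share the vertex `z`, and `w` is `x` or `y`, then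
a detour over `z` leads from `u` to `w` within two thirds of the radius of `u`, provided that the
radius of `x` is not larger. -/
lemma lt_radius_of_crossing {A : Set (Fin n)} {u v x y z w : Fin n}
    (huv : wdist G ω u v < 1 / 3 * radius G ω A u) (hxy : wdist G ω x y < 1 / 3 * radius G ω A x)
    (hz : wdist G ω u z ≤ wdist G ω u v) (hw : wdist G ω z w ≤ wdist G ω x y)
    (hr : radius G ω A x ≤ radius G ω A u) : wdist G ω u w < radius G ω A u := by
  calc wdist G ω u w ≤ wdist G ω u z + wdist G ω z w := wdist_triangle ω _ _ _
    _ ≤ wdist G ω u v + wdist G ω x y := add_le_add hz hw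
    _ < 1 / 3 * radius G ω A u + 1 / 3 * radius G ω A u :=
        ENNReal.add_lt_add huv (hxy.trans_le (mul_le_mul_right hr _))
    _ = 2 / 3 * radius G ω A u := by
        rw [← add_mul, ENNReal.div_add_div_same]; norm_num
    _ ≤ 1 * radius G ω A u := by
        gcongr
        exact ENNReal.div_le_of_le_mul (by norm_num)
    _ = radius G ω A u := one_mul _

lemma lt_radius_of_lt_third {A : Set (Fin n)} {u v : Fin n}
    (huv : wdist G ω u v < 1 / 3 * radius G ω A u) : wdist G ω u v < radius G ω A u := by
  refine huv.trans_le ((mul_le_mul_left ?_ _).trans_eq (one_mul _))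
  exact ENNReal.div_le_of_le_mul (by norm_num)

/-- If two paths of the same level cross, then the endpoint with the larger ball, among the two
endpoints whose third-balls contain the respective other endpoint, has all the endpoints in its
ball. -/
lemma mem_clusters_of_crossing {u v x y z : Fin n}
    (hu : u ∈ L i) (hv : v ∈ L i) (hx : x ∈ L i) (hy : y ∈ L i)
    (huv : wdist G ω u v < 1 / 3 * radius G ω (L (i + 1)) u)
    (hxy : wdist G ω x y < 1 / 3 * radius G ω (L (i + 1)) x)
    (hzu : wdist G ω u z ≤ wdist G ω u v) (hzv : wdist G ω z v ≤ wdist G ω u v)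
    (hzx : wdist G ω x z ≤ wdist G ω x y) (hzy : wdist G ω z y ≤ wdist G ω x y) :
    ((u, ![v, x, y]) ∈ clusters G ω h L i ∧ (u, ![v, y, x]) ∈ clusters G ω h L i) ∨
      ((x, ![y, u, v]) ∈ clusters G ω h L i ∧ (x, ![y, v, u]) ∈ clusters G ω h L i) := by
  have hzx' := hzx
  have hzu' := hzu
  rw [wdist_comm] at hzx' hzu'
  rcases le_total (radius G ω (L (i + 1)) x) (radius G ω (L (i + 1)) u) with hr | hr
  · left
    simp [clusters, Fin.forall_fin_succ, hu, hv, hx, hy, lt_radius_of_lt_third huv,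
      lt_radius_of_crossing huv hxy hzu hzx' hr, lt_radius_of_crossing huv hxy hzu hzy hr]
  · right
    simp [clusters, Fin.forall_fin_succ, hu, hv, hx, hy, lt_radius_of_lt_third hxy,
      lt_radius_of_crossing hxy huv hzx hzu' hr, lt_radius_of_crossing hxy huv hzx hzv hr]

/-- A crossing pair of paths arises from a cluster in one of four ways: the centre of the cluster is
the start or the end of the first or of the second path. -/
lemma Dppro.card_crossings_le (D : Dppro G ω (landmarkPairs G ω h L i)) :
    D.crossings.card ≤ 4 * (clusters G ω h L i).card := by
  classical
  set Q := clusters G ω h L i with hQ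
  have hsub : D.crossings ⊆
      ((Q.image fun c => ((c.1, c.2 0), (c.2 1, c.2 2))) ∪
        (Q.image fun c => ((c.2 0, c.1), (c.2 1, c.2 2)))) ∪
      ((Q.image fun c => ((c.2 1, c.2 2), (c.1, c.2 0))) ∪
        (Q.image fun c => ((c.2 1, c.2 2), (c.2 0, c.1)))) := by
    rintro ⟨⟨a₁, a₂⟩, ⟨b₁, b₂⟩⟩ hc
    obtain ⟨ha, hb, z, hza, hzb⟩ := (Finset.mem_filter.1 hc).2
    obtain ⟨ha₁, ha₂⟩ := D.wdist_le_of_mem_path ha hza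
    obtain ⟨hb₁, hb₂⟩ := D.wdist_le_of_mem_path hb hzb
    obtain ⟨-, la₁, la₂, ha⟩ := ha
    obtain ⟨-, lb₁, lb₂, hb⟩ := hb
    simp only at *
    simp only [Finset.mem_union, Finset.mem_image]
    by_cases hi : i < h
    · rw [if_pos hi] at ha hb
      have ha₁' := ha₁
      have ha₂' := ha₂
      have hb₁' := hb₁
      have hb₂' := hb₂
      rw [wdist_comm ω a₁ a₂] at ha₁' ha₂'
      rw [wdist_comm ω b₁ b₂] at hb₁' hb₂'
      rw [wdist_comm] at ha₁' ha₂' hb₁' hb₂'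
      rcases ha with ha | ha <;> rcases hb with hb | hb
      · rcases mem_clusters_of_crossing la₁ la₂ lb₁ lb₂ ha hb ha₁ ha₂ hb₁ hb₂ with h | h
        · exact .inl (.inl ⟨_, h.1, rfl⟩)
        · exact .inr (.inl ⟨_, h.1, rfl⟩)
      · rcases mem_clusters_of_crossing la₁ la₂ lb₂ lb₁ ha hb ha₁ ha₂ hb₂' hb₁' with h | h
        · exact .inl (.inl ⟨_, h.2, rfl⟩)
        · exact .inr (.inr ⟨_, h.1, rfl⟩)
      · rcases mem_clusters_of_crossing la₂ la₁ lb₁ lb₂ ha hb ha₂' ha₁' hb₁ hb₂ with h | h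
        · exact .inl (.inr ⟨_, h.1, rfl⟩)
        · exact .inr (.inl ⟨_, h.2, rfl⟩)
      · rcases mem_clusters_of_crossing la₂ la₁ lb₂ lb₁ ha hb ha₂' ha₁' hb₂' hb₁' with h | h
        · exact .inl (.inr ⟨_, h.2, rfl⟩)
        · exact .inr (.inr ⟨_, h.2, rfl⟩)
    · refine .inl (.inl ⟨(a₁, ![a₂, b₁, b₂]), ?_, rfl⟩)
      simp [hQ, clusters, Fin.forall_fin_succ, hi, la₁, la₂, lb₁, lb₂]
  refine (Finset.card_le_card hsub).trans ((Finset.card_union_le _ _).trans ?_)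
  have h₁ := Finset.card_union_le (Q.image fun c => ((c.1, c.2 0), (c.2 1, c.2 2)))
    (Q.image fun c => ((c.2 0, c.1), (c.2 1, c.2 2)))
  have h₂ := Finset.card_union_le (Q.image fun c => ((c.2 1, c.2 2), (c.1, c.2 0)))
    (Q.image fun c => ((c.2 1, c.2 2), (c.2 0, c.1)))
  have e₁ := Finset.card_image_le (s := Q) (f := fun c => ((c.1, c.2 0), (c.2 1, c.2 2)))
  have e₂ := Finset.card_image_le (s := Q) (f := fun c => ((c.2 0, c.1), (c.2 1, c.2 2)))
  have e₃ := Finset.card_image_le (s := Q) (f := fun c => ((c.2 1, c.2 2), (c.1, c.2 0)))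
  have e₄ := Finset.card_image_le (s := Q) (f := fun c => ((c.2 1, c.2 2), (c.2 0, c.1)))
  omega

end Clusters

/-! ### The space in terms of clusters -/

section Space

variable {n : ℕ} {G : SimpleGraph (Fin n)} {ω : Sym2 (Fin n) → ℝ≥0} {h : ℕ} {L : ℕ → Set (Fin n)}

lemma Oracle.mem_memory_iff (O : Oracle G ω h L) {e : Entry} :
    e ∈ O.memory ↔ ∃ i, (1 ≤ i ∧ i ≤ h) ∧
      (e ∈ (O.forest i).table i ∨ e ∈ (O.dppro i).pairTable i ∨ e ∈ (O.dppro i).homeTable i ∨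
        e ∈ (O.dppro i).branchTable i) := by
  simp [Oracle.memory]

lemma Oracle.size_le (O : Oracle G ω h L) {e : Entry} (he : e ∈ O.memory) : e.size ≤ 15 := by
  classical
  obtain ⟨i, -, he⟩ := O.mem_memory_iff.1 he
  rcases he with he | he | he | he <;>
  · obtain ⟨x, -, rfl⟩ := Finset.mem_image.1 he
    simp [Entry.size]

lemma Oracle.space_le (hω : ∀ e ∈ G.edgeSet, 0 < ω e) (O : Oracle G ω h L) :
    O.memory.space ≤ ∑ i ∈ Finset.Icc 1 h, (30 * n + 180 * (clusters G ω h L i).card) := by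
  classical
  -- Per level: `n` records each in the tables 0 and 2, one record for each of the at most
  -- `4 * #clusters` crossings in table 1 and two in table 3. A record has at most 15 words.
  have hcard : O.memory.card ≤ ∑ i ∈ Finset.Icc 1 h, (2 * n + 12 * (clusters G ω h L i).card) := by
    refine Finset.card_biUnion_le.trans (Finset.sum_le_sum fun i _ => ?_)
    have h₁ : ((O.forest i).table i).card ≤ n :=
      Finset.card_image_le.trans ((Finset.card_le_univ _).trans (by simp))
    have h₂ : ((O.dppro i).pairTable i).card ≤ (O.dppro i).crossings.card :=
      Finset.card_image_le.trans (O.dppro i).card_pairs_le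
    have h₃ : ((O.dppro i).homeTable i).card ≤ n :=
      Finset.card_image_le.trans ((Finset.card_le_univ _).trans (by simp))
    have h₄ : ((O.dppro i).branchTable i).card ≤ 2 * (O.dppro i).crossings.card :=
      Finset.card_image_le.trans
        ((O.dppro i).card_branching_le hω fun _ => landmarkPairs_swap)
    have h₅ := (O.dppro i).card_crossings_le
    refine (Finset.card_union_le _ _).trans ((add_le_add_left (Finset.card_union_le _ _) _).trans
      ((add_le_add_left (add_le_add_left (Finset.card_union_le _ _) _) _).trans ?_))
    omega
  calc O.memory.space ≤ O.memory.card * 15 :=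
        Finset.sum_le_card_nsmul _ _ _ fun e he => O.size_le he
    _ ≤ (∑ i ∈ Finset.Icc 1 h, (2 * n + 12 * (clusters G ω h L i).card)) * 15 :=
        Nat.mul_le_mul_right _ hcard
    _ = _ := by rw [Finset.sum_mul]; exact Finset.sum_congr rfl fun i _ => by ring

/-- The integers in memory are vertices, the number `n` for NULL, table numbers (at most 3), and
levels. -/
lemma Oracle.word_le (O : Oracle G ω h L) (hn : 3 ≤ n) {e : Entry} (he : e ∈ O.memory) {k : ℕ}
    (hk : k ∈ e.key ++ e.ids) : k ≤ n + h := by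
  have hcode : ∀ o : Option (Fin n), code o ≤ n := by
    rintro (_ | x)
    · exact le_rfl
    · exact x.2.le
  classical
  obtain ⟨i, hi, he⟩ := O.mem_memory_iff.1 he
  rcases he with he | he | he | he <;>
  · obtain ⟨x, -, rfl⟩ := Finset.mem_image.1 he
    simp only [List.mem_append, List.mem_cons, List.not_mem_nil, or_false] at hk
    have hc := hcode
    rcases hk with hk | hk <;> (try rcases hk with rfl | hk) <;> (try rcases hk with rfl | hk) <;>
      (try rcases hk with rfl | hk) <;> (try rcases hk with rfl | hk) <;>
      (try rcases hk with rfl | hk) <;> (try rcases hk with rfl | hk) <;>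
      (try subst hk) <;>
      first
      | omega
      | exact (hc _).trans (Nat.le_add_right _ _)

end Space

/-! ### Independent coins -/

section Coins

open Classical in
/-- The probability that a coin with success probability `p` shows the outcome `b`. -/
noncomputable def coin (p : ℝ) (b : Prop) : ℝ := if b then p else 1 - p

variable {ι : Type*} [Fintype ι] [DecidableEq ι]

lemma sum_prop {M : Type*} [AddCommMonoid M] (f : Prop → M) : ∑ b : Prop, f b = f True + f False := by
  rw [Fintype.sum_eq_add True False (by simp)]
  intro x hx
  by_cases h : x <;> simp_all

open Classical in
/-- Constraints on different coins are independent. -/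
lemma sum_coin_forall (p : ι → ℝ) (c : ι → Prop → Prop) :
    (∑ b : ι → Prop, if ∀ k, c k (b k) then ∏ k, coin (p k) (b k) else 0) =
      ∏ k, ((if c k True then p k else 0) + if c k False then 1 - p k else 0) := by
  have h₁ : ∀ k, ((if c k True then p k else 0) + if c k False then 1 - p k else 0) =
      ∑ b ∈ (Finset.univ : Finset Prop), if c k b then coin (p k) b else 0 := fun k => by
    rw [sum_prop]; simp [coin]
  simp_rw [h₁]
  rw [Finset.prod_univ_sum, Fintype.piFinset_univ]
  refine Finset.sum_congr rfl fun b _ => ?_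
  rw [Finset.prod_ite_zero]
  simp

open Classical in
lemma sum_coin_of_imp (p : ι → ℝ) (i : ι) (a : Prop) :
    (∑ b : ι → Prop, if a → b i then ∏ k, coin (p k) (b k) else 0) = if a then p i else 1 := by
  obtain ⟨c, hc⟩ : ∃ c : ι → Prop → Prop, ∀ k x, c k x ↔ (k = i → a → x) := ⟨_, fun _ _ => Iff.rfl⟩
  have h := (sum_coin_forall p c).trans (Finset.prod_congr rfl
    (g := fun k => if k = i then (if a then p i else 1) else 1) fun k _ => by
    by_cases hk : k = i
    · subst hk; by_cases ha : a <;> simp [hc, ha]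
    · simp [hc, hk])
  simp only [Finset.prod_ite_eq', Finset.mem_univ, if_true] at h
  rw [← h]
  refine Finset.sum_congr rfl fun b _ => if_congr ?_ rfl rfl
  simp [hc]

open Classical in
/-- The joint probability that the coin `i` shows a success (if `a`) and that the coin `j` does not
show the last success among the coins `j` and `J` (if `d`). -/
lemma sum_coin_of_imp_and (p : ι → ℝ) {i j : ι} {J : Finset ι} (hij : i ≠ j) (hi : i ∉ J)
    (hj : j ∉ J) (a d : Prop) :
    (∑ b : ι → Prop, if (a → b i) ∧ (d → ¬ (b j ∧ ∀ k ∈ J, ¬ b k)) then ∏ k, coin (p k) (b k) else 0)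
      = (if a then p i else 1) * if d then 1 - p j * ∏ k ∈ J, (1 - p k) else 1 := by
  by_cases hd : d
  swap
  · simp [hd, sum_coin_of_imp p i a]
  obtain ⟨c, hc⟩ : ∃ c : ι → Prop → Prop,
      ∀ k x, c k x ↔ (k = i → a → x) ∧ (k = j → x) ∧ (k ∈ J → ¬ x) := ⟨_, fun _ _ => Iff.rfl⟩
  have h := (sum_coin_forall p c).trans (Finset.prod_congr rfl
    (g := fun k => (if k = i then (if a then p i else 1) else 1) * (if k = j then p j else 1) *
        if k ∈ J then 1 - p k else 1) fun k _ => by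
    by_cases hki : k = i
    · subst hki; by_cases ha : a <;> simp [hc, ha, hij, hi]
    · by_cases hkj : k = j
      · subst hkj; simp [hc, hki, hj]
      · by_cases hkJ : k ∈ J <;> simp [hc, hki, hkj, hkJ])
  simp only [Finset.prod_mul_distrib, Finset.prod_ite_eq', Finset.mem_univ, if_true,
    Finset.prod_ite_mem, Finset.univ_inter] at h
  have key : ∀ b : ι → Prop,
      (if (a → b i) ∧ (d → ¬ (b j ∧ ∀ k ∈ J, ¬ b k)) then ∏ k, coin (p k) (b k) else 0) =
      (if a → b i then ∏ k, coin (p k) (b k) else 0) -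
        if ∀ k, c k (b k) then ∏ k, coin (p k) (b k) else 0 := fun b => by
    have : (∀ k, c k (b k)) ↔
        (a → b i) ∧ b j ∧ ∀ k ∈ J, ¬ b k := by
      simp only [hc]
      exact ⟨fun H => ⟨(H i).1 rfl, (H j).2.1 rfl, fun k => (H k).2.2⟩,
        fun H k => ⟨fun hk => hk ▸ H.1, fun hk => hk ▸ H.2.1, H.2.2 k⟩⟩
    by_cases h₁ : a → b i
    · by_cases h₂ : b j ∧ ∀ k ∈ J, ¬ b k
      · rw [if_neg fun H => H.2 hd h₂, if_pos h₁, if_pos (this.2 ⟨h₁, h₂⟩), sub_self]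
      · rw [if_pos ⟨h₁, fun _ => h₂⟩, if_pos h₁, if_neg fun H => h₂ (this.1 H).2, sub_zero]
    · rw [if_neg fun H => h₁ H.1, if_neg h₁, if_neg fun H => h₁ (this.1 H).1, sub_zero]
  rw [Finset.sum_congr rfl fun b _ => key b, Finset.sum_sub_distrib, sum_coin_of_imp, h, if_pos hd]
  ring

end Coins

/-! ### Probabilities of sampling events -/

section Sampling

variable {n : ℕ}

instance : IsProbabilityMeasure (sampling n) := by unfold sampling; infer_instance

open Classical in
lemma sampling_real_singleton (S : Sample n) :
    (sampling n).real {S} = ∏ v, ∏ i : Finset.Icc 1 (levels n), coin (sampleProb n i) (v ∈ S i) := by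
  rw [Finset.prod_comm, measureReal_def, sampling, Measure.pi_singleton, ENNReal.toReal_prod]
  refine Finset.prod_congr rfl fun i _ => ?_
  rw [← measureReal_def, setBernoulli_real_singleton _ (Set.subset_univ _) Set.finite_univ]
  simp only [coin]
  rw [Finset.prod_ite, Finset.prod_const, Finset.prod_const]
  congr 2
  · rw [← Set.ncard_coe_finset]; congr 1; ext; simp
  · rw [← Set.ncard_coe_finset]; congr 1; ext; simp

open Classical in
/-- Events that concern different vertices are independent. -/
lemma sampling_real_forall (c : Fin n → (Finset.Icc 1 (levels n) → Prop) → Prop) :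
    (sampling n).real {S | ∀ v, c v fun i => v ∈ S i} =
      ∏ v, ∑ b : Finset.Icc 1 (levels n) → Prop,
        if c v b then ∏ i : Finset.Icc 1 (levels n), coin (sampleProb n i) (b i) else 0 := by
  have h₁ : {S : Sample n | ∀ v, c v fun i => v ∈ S i} =
      ↑(Finset.univ.filter fun S : Sample n => ∀ v, c v fun i => v ∈ S i) := by ext; simp
  rw [h₁, ← sum_measureReal_singleton, Finset.prod_univ_sum, Fintype.piFinset_univ, Finset.sum_filter]
  let e : Sample n ≃ (Fin n → Finset.Icc 1 (levels n) → Prop) :=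
    { toFun := fun S v i => v ∈ S i
      invFun := fun b i => {v | b v i}
      left_inv := fun S => rfl
      right_inv := fun b => rfl }
  refine Fintype.sum_equiv e _ _ fun S => ?_
  rw [Finset.prod_ite_zero, sampling_real_singleton]
  simp [e]

lemma sampling_real_subset (A : Finset (Fin n)) (i : Finset.Icc 1 (levels n)) :
    (sampling n).real {S | ∀ v ∈ A, v ∈ S i} = (sampleProb n i : ℝ) ^ A.card := by
  classical
  have := sampling_real_forall (n := n) fun v b => v ∈ A → b i
  refine (Eq.trans ?_ this).trans ?_
  · rfl
  · refine (Finset.prod_congr rfl (g := fun v => if v ∈ A then (sampleProb n i : ℝ) else 1)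
      fun v _ => ?_).trans ?_
    · convert sum_coin_of_imp (fun i : Finset.Icc 1 (levels n) => (sampleProb n i : ℝ)) i (v ∈ A)
    rw [Finset.prod_ite_mem, Finset.univ_inter, Finset.prod_const]

/-- The probability that a vertex belongs to the set of level `j` of `disjointLandmarks`, for
`j ≥ 2`: it is sampled into level `j` and into no higher level. -/
noncomputable def thinnedProb (n : ℕ) (j : Finset.Icc 1 (levels n)) : ℝ :=
  sampleProb n j * ∏ k ∈ Finset.univ.filter (j < ·), (1 - (sampleProb n k : ℝ))

/-- The joint probability that all of `A` is sampled into level `i` and that, after the sets have been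
made disjoint, none of `D` is a landmark of the higher level `j`. The sets `A` and `D` may
overlap. -/
lemma sampling_real_subset_and (A D : Finset (Fin n)) {i j : Finset.Icc 1 (levels n)} (hij : i < j) :
    (sampling n).real {S | (∀ v ∈ A, v ∈ S i) ∧ ∀ v ∈ D, ¬ (v ∈ S j ∧ ∀ k, j < k → v ∉ S k)} =
      (sampleProb n i : ℝ) ^ A.card * (1 - thinnedProb n j) ^ D.card := by
  classical
  have := sampling_real_forall (n := n) fun v b => (v ∈ A → b i) ∧
    (v ∈ D → ¬ (b j ∧ ∀ k ∈ Finset.univ.filter (j < ·), ¬ b k))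
  refine (Eq.trans ?_ this).trans ?_
  · congr 1; ext S; simp [forall_and]
  · refine (Finset.prod_congr rfl (g := fun v => (if v ∈ A then (sampleProb n i : ℝ) else 1) *
      if v ∈ D then 1 - thinnedProb n j else 1) fun v _ => ?_).trans ?_
    · convert sum_coin_of_imp_and (fun i : Finset.Icc 1 (levels n) => (sampleProb n i : ℝ)) hij.ne
        (show i ∉ Finset.univ.filter (j < ·) by simpa using hij.le)
        (show j ∉ Finset.univ.filter (j < ·) by simp) (v ∈ A) (v ∈ D) using 3
      rw [thinnedProb]
    rw [Finset.prod_mul_distrib, Finset.prod_ite_mem, Finset.univ_inter, Finset.prod_const,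
      Finset.prod_ite_mem, Finset.univ_inter, Finset.prod_const]

end Sampling

/-! ### Sums over sets of vertices in a ball -/

section Counting

/-- If every vertex ends the ball with probability `q = 1 - x`, then the expected number of
`k`-subsets of the ball is at most `q⁻ᵏ`, the bound for a geometrically distributed size. The
recursion conditions on the vertex with the smallest distance `f`. -/
lemma sum_powersetCard_le {α β : Type*} [DecidableEq α] [LinearOrder β] (f : α → β) {x : ℝ}
    (hx₀ : 0 ≤ x) (hx₁ : x < 1) (V : Finset α) (k : ℕ) :
    ∑ S ∈ V.powersetCard k, x ^ (V.filter fun w => ∃ s ∈ S, f w ≤ f s).card ≤ ((1 - x)⁻¹) ^ k := by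
  have hq : 0 < 1 - x := sub_pos.2 hx₁
  induction V using Finset.induction_on_min_value f generalizing k with
  | empty =>
    cases k with
    | zero => simp
    | succ k => rw [Finset.powersetCard_eq_empty.2 (by simp)]; simp only [Finset.sum_empty]; positivity
  | insert a s ha hmin ih =>
    cases k with
    | zero => simp
    | succ k =>
      have hdisj : Disjoint (s.powersetCard (k + 1)) ((s.powersetCard k).image (insert a)) := by
        rw [Finset.disjoint_left]
        intro S hS hS'
        obtain ⟨T, -, rfl⟩ := Finset.mem_image.1 hS'
        exact ha ((Finset.mem_powersetCard.1 hS).1 (Finset.mem_insert_self a T))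
      rw [Finset.powersetCard_succ_insert ha, Finset.sum_union hdisj, Finset.sum_image]
      swap
      · intro S hS T hT h
        have hS' : a ∉ S := fun h => ha ((Finset.mem_powersetCard.1 hS).1 h)
        have hT' : a ∉ T := fun h => ha ((Finset.mem_powersetCard.1 hT).1 h)
        rw [← Finset.erase_insert hS', h, Finset.erase_insert hT']
      have h₁ : ∀ S ∈ s.powersetCard (k + 1),
          x ^ ((insert a s).filter fun w => ∃ t ∈ S, f w ≤ f t).card ≤
            x * x ^ (s.filter fun w => ∃ t ∈ S, f w ≤ f t).card := fun S hS => by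
        obtain ⟨hSs, hc⟩ := Finset.mem_powersetCard.1 hS
        obtain ⟨t, ht⟩ := Finset.card_pos.1 (by omega : 0 < S.card)
        rw [Finset.filter_insert, if_pos ⟨t, ht, hmin t (hSs ht)⟩,
          Finset.card_insert_of_notMem (by simp [ha]), pow_succ']
      have h₂ : ∀ S ∈ s.powersetCard k,
          x ^ ((insert a s).filter fun w => ∃ t ∈ insert a S, f w ≤ f t).card ≤
            x * x ^ (s.filter fun w => ∃ t ∈ S, f w ≤ f t).card := fun S _ => by
        rw [← pow_succ']
        refine pow_le_pow_of_le_one hx₀ hx₁.le ?_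
        rw [Finset.filter_insert, if_pos ⟨a, by simp, le_rfl⟩,
          Finset.card_insert_of_notMem (by simp [ha])]
        refine Nat.succ_le_succ (Finset.card_le_card fun w hw => ?_)
        simp only [Finset.mem_filter] at hw ⊢
        obtain ⟨hw, t, ht, hle⟩ := hw
        exact ⟨hw, t, Finset.mem_insert_of_mem ht, hle⟩
      refine (add_le_add (Finset.sum_le_sum h₁) (Finset.sum_le_sum h₂)).trans ?_
      rw [← Finset.mul_sum, ← Finset.mul_sum]
      refine (add_le_add (mul_le_mul_of_nonneg_left (ih (k + 1)) hx₀)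
        (mul_le_mul_of_nonneg_left (ih k) hx₀)).trans ?_
      have hpow : ((1 - x)⁻¹) ^ k = (1 - x) * ((1 - x)⁻¹) ^ (k + 1) := by
        rw [pow_succ']; field_simp
      rw [hpow]
      have : 0 ≤ ((1 - x)⁻¹) ^ (k + 1) := by positivity
      nlinarith [mul_nonneg (sq_nonneg (1 - x)) this]

/-- Every set `S` with at most three elements arises from at most `4 ^ 3` triples `g` as the set of
the elements of `g` other than `u`. -/
lemma sum_triples_le {α : Type*} [Fintype α] [DecidableEq α] (u : α) {F : Finset α → ℝ}
    (hF : ∀ S, 0 ≤ F S) :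
    ∑ g : Fin 3 → α, F ((Finset.univ.image g).erase u) ≤
      64 * ∑ k ∈ Finset.range 4, ∑ S ∈ Finset.univ.powersetCard k, F S := by
  have hsets : ∑ k ∈ Finset.range 4, ∑ S ∈ (Finset.univ : Finset α).powersetCard k, F S =
      ∑ S ∈ Finset.univ.filter (fun S : Finset α => S.card ∈ Finset.range 4), F S := by
    rw [← Finset.sum_fiberwise_of_maps_to
      (s := Finset.univ.filter fun S : Finset α => S.card ∈ Finset.range 4)
      (t := Finset.range 4) (g := Finset.card) (fun S hS => (Finset.mem_filter.1 hS).2)]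
    refine Finset.sum_congr rfl fun k hk => Finset.sum_congr ?_ fun _ _ => rfl
    ext S
    simp only [Finset.mem_powersetCard, Finset.subset_univ, true_and, Finset.mem_filter,
      Finset.mem_univ]
    exact ⟨fun h => ⟨h ▸ hk, h⟩, fun h => h.2⟩
  have hmaps : ∀ g ∈ (Finset.univ : Finset (Fin 3 → α)), (Finset.univ.image g).erase u ∈
      Finset.univ.filter (fun S : Finset α => S.card ∈ Finset.range 4) := fun g _ => by
    have h₁ := Finset.card_erase_le (s := Finset.univ.image g) (a := u)
    have h₂ : (Finset.univ.image g).card ≤ 3 := by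
      simpa using Finset.card_image_le (s := Finset.univ) (f := g)
    simp only [Finset.mem_filter, Finset.mem_univ, true_and, Finset.mem_range]
    omega
  rw [hsets, ← Finset.sum_fiberwise_of_maps_to hmaps, Finset.mul_sum]
  refine Finset.sum_le_sum fun S hS => ?_
  have hconst : ∀ g ∈ Finset.univ.filter (fun g : Fin 3 → α => (Finset.univ.image g).erase u = S),
      F ((Finset.univ.image g).erase u) ≤ F S := fun g hg => by rw [(Finset.mem_filter.1 hg).2]
  refine (Finset.sum_le_card_nsmul _ _ _ hconst).trans ?_
  rw [nsmul_eq_mul]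
  refine mul_le_mul_of_nonneg_right ?_ (hF S)
  have hsub : Finset.univ.filter (fun g : Fin 3 → α => (Finset.univ.image g).erase u = S) ⊆
      Fintype.piFinset fun _ => insert u S := fun g hg => by
    rw [Fintype.mem_piFinset]
    intro k
    rw [← (Finset.mem_filter.1 hg).2]
    by_cases h : g k = u
    · simp [h]
    · simp [h]
  have hcard := Finset.card_le_card hsub
  rw [Fintype.card_piFinset, Finset.prod_const, Finset.card_univ, Fintype.card_fin] at hcard
  have hS' : S.card < 4 := by simpa using (Finset.mem_filter.1 hS).2
  have hins : (insert u S).card ≤ 4 := (Finset.card_insert_le _ _).trans hS'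
  have : (insert u S).card ^ 3 ≤ 4 ^ 3 := Nat.pow_le_pow_left hins 3
  exact_mod_cast hcard.trans this

end Counting

/-! ### The sampling probabilities -/

section Probabilities

variable {n : ℕ}

lemma sampleProb_eq (hn : 1 ≤ n) (i : ℕ) : (sampleProb n i : ℝ) = min 1 (rho n i / n) := by
  rw [sampleProb, Set.coe_projIcc, max_eq_right]
  refine le_min zero_le_one (div_nonneg (Real.rpow_nonneg (by positivity) _) (by positivity))

lemma two_rpow_logb_add_one (hn : 1 ≤ n) : (2 : ℝ) ^ (Real.logb 2 n + 1) = 2 * n := by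
  have : (0 : ℝ) < n := by exact_mod_cast hn
  rw [Real.rpow_add two_pos, Real.rpow_logb two_pos (by norm_num) this, Real.rpow_one, mul_comm]

lemma rho_div_eq (hn : 1 ≤ n) (i : ℕ) :
    rho n i / n = 2 ^ (1 - (3 / 4 : ℝ) ^ (levels n + 1 - i) * (Real.logb 2 n + 1)) := by
  have hn' : (0 : ℝ) < n := by exact_mod_cast hn
  have h2n : (0 : ℝ) < 2 * n := by positivity
  rw [rho, Real.rpow_sub h2n, Real.rpow_one, Real.rpow_sub two_pos, Real.rpow_one,
    ← two_rpow_logb_add_one hn, mul_comm, Real.rpow_mul two_pos.le, two_rpow_logb_add_one hn]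
  field_simp

lemma one_lt_logb_add_one (hn : 3 ≤ n) : 2 < Real.logb 2 n + 1 := by
  have : (1 : ℝ) < Real.logb 2 n := by
    rw [Real.lt_logb_iff_rpow_lt one_lt_two (by positivity), Real.rpow_one]
    exact_mod_cast (by omega : 2 < n)
  linarith

lemma levels_pos (hn : 3 ≤ n) : 1 ≤ levels n := by
  have := one_lt_logb_add_one hn
  rw [levels, Nat.one_le_ceil_iff]
  exact Real.logb_pos (by norm_num) (by linarith)

lemma logb_add_one_le (hn : 3 ≤ n) : Real.logb 2 n + 1 ≤ (4 / 3 : ℝ) ^ levels n := by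
  have := one_lt_logb_add_one hn
  have h := Nat.le_ceil (Real.logb (4 / 3) (Real.logb 2 n + 1))
  rw [Real.logb_le_iff_le_rpow (by norm_num) (by linarith)] at h
  exact_mod_cast h

lemma lt_logb_add_one (hn : 3 ≤ n) : (4 / 3 : ℝ) ^ (levels n - 1) < Real.logb 2 n + 1 := by
  have := one_lt_logb_add_one hn
  have h₀ := levels_pos hn
  have h := Nat.lt_ceil.1 (show levels n - 1 < ⌈Real.logb (4 / 3) (Real.logb 2 n + 1)⌉₊ by
    change levels n - 1 < levels n; omega)
  rw [Real.lt_logb_iff_rpow_lt (by norm_num) (by linarith)] at h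
  exact_mod_cast h

lemma sampleProb_one (hn : 3 ≤ n) : (sampleProb n 1 : ℝ) = 1 := by
  rw [sampleProb_eq (by omega), rho_div_eq (by omega), min_eq_left]
  refine Real.one_le_rpow one_le_two ?_
  rw [Nat.add_sub_cancel, sub_nonneg]
  calc (3 / 4 : ℝ) ^ levels n * (Real.logb 2 n + 1)
      ≤ (3 / 4 : ℝ) ^ levels n * (4 / 3 : ℝ) ^ levels n := by
        gcongr; exact logb_add_one_le hn
    _ = 1 := by rw [← mul_pow]; norm_num

/-- From level 3 on, the sampling probabilities are dominated by a geometric sequence. -/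
lemma sampleProb_le_geometric (hn : 3 ≤ n) {j : ℕ} (hj : 3 ≤ j) (hjh : j ≤ levels n) :
    (sampleProb n j : ℝ) ≤ (4 / 5 : ℝ) ^ (j - 2) := by
  obtain ⟨m, rfl⟩ := Nat.exists_eq_add_of_le' (show 2 ≤ j by omega)
  rw [sampleProb_eq (by omega), rho_div_eq (by omega), Nat.add_sub_cancel]
  refine (min_le_right _ _).trans ?_
  have h₁ : (1 : ℝ) + m / 3 ≤ (4 / 3) ^ m := by
    have := one_add_mul_le_pow (a := (1 / 3 : ℝ)) (by norm_num) m
    norm_num at this ⊢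
    linarith
  have h₂ : (4 / 3 : ℝ) ^ m ≤
      (3 / 4 : ℝ) ^ (levels n + 1 - (m + 2)) * (Real.logb 2 n + 1) := by
    have hexp : levels n - 1 = m + (levels n + 1 - (m + 2)) := by omega
    have := (lt_logb_add_one hn).le
    rw [hexp, pow_add] at this
    calc (4 / 3 : ℝ) ^ m = (3 / 4 : ℝ) ^ (levels n + 1 - (m + 2)) *
          ((4 / 3 : ℝ) ^ m * (4 / 3 : ℝ) ^ (levels n + 1 - (m + 2))) := by
          rw [mul_left_comm, ← mul_pow]; norm_num
      _ ≤ _ := by gcongr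
  calc (2 : ℝ) ^ (1 - (3 / 4 : ℝ) ^ (levels n + 1 - (m + 2)) * (Real.logb 2 n + 1))
      ≤ 2 ^ ((-1 / 3 : ℝ) * m) := Real.rpow_le_rpow_of_exponent_le one_le_two (by linarith)
    _ = (2 ^ (-1 / 3 : ℝ)) ^ m := by rw [Real.rpow_mul two_pos.le, Real.rpow_natCast]
    _ ≤ (4 / 5) ^ m := by
        refine pow_le_pow_left₀ (by positivity) ?_ m
        refine le_of_pow_le_pow_left₀ (n := 3) (by norm_num) (by norm_num) ?_
        rw [← Real.rpow_natCast, ← Real.rpow_mul two_pos.le]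
        norm_num

lemma exp_neg_le_one_sub {q : ℝ} (h₀ : 0 ≤ q) (h₁ : q ≤ 4 / 5) : Real.exp (-(5 * q)) ≤ 1 - q := by
  have hpos : 0 < 1 - q := by linarith
  rw [← Real.le_log_iff_exp_le hpos]
  refine le_trans ?_ (Real.one_sub_inv_le_log_of_pos hpos)
  rw [← sub_nonneg]
  have : 1 - (1 - q)⁻¹ - -(5 * q) = q * (4 - 5 * q) * (1 - q)⁻¹ := by field_simp; ring
  rw [this]
  have : 0 ≤ 4 - 5 * q := by linarith
  positivity

/-- Making the landmark sets disjoint changes the sampling probabilities above level 1 only by a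
constant factor. -/
lemma le_thinnedProb (hn : 3 ≤ n) (j : Finset.Icc 1 (levels n)) (hj : 2 ≤ (j : ℕ)) :
    Real.exp (-25) * sampleProb n j ≤ thinnedProb n j := by
  have hmem : ∀ k ∈ Finset.univ.filter (j < ·), 3 ≤ (k : ℕ) ∧ (k : ℕ) ≤ levels n := fun k hk => by
    have h₁ : (j : ℕ) < k := by simpa using hk
    exact ⟨by omega, (Finset.mem_Icc.1 k.2).2⟩
  -- The product of the `1 - p_k` is at least `exp (-5 ∑ p_k)`, and the sum of the `p_k` at most 5.
  have hsum : ∑ k ∈ Finset.univ.filter (j < ·), (4 / 5 : ℝ) ^ ((k : ℕ) - 2) ≤ 5 := by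
    have hinj : Set.InjOn (fun k : Finset.Icc 1 (levels n) => (k : ℕ) - 2)
        (Finset.univ.filter (j < ·)) := fun a ha b hb hab => by
      have h₁ := (hmem a ha).1
      have h₂ := (hmem b hb).1
      exact Subtype.ext (by simp only at hab; omega)
    rw [← Finset.sum_image (f := fun m : ℕ => (4 / 5 : ℝ) ^ m) hinj]
    refine ((summable_geometric_of_lt_one (by norm_num) (by norm_num)).sum_le_tsum _
      fun _ _ => by positivity).trans_eq ?_
    rw [tsum_geometric_of_lt_one (by norm_num) (by norm_num)]
    norm_num
  rw [thinnedProb, mul_comm]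
  refine mul_le_mul_of_nonneg_left ?_ (sampleProb n j).2.1
  calc Real.exp (-25)
      ≤ Real.exp (∑ k ∈ Finset.univ.filter (j < ·), -(5 * (4 / 5 : ℝ) ^ ((k : ℕ) - 2))) := by
        rw [Real.exp_le_exp, Finset.sum_neg_distrib, ← Finset.mul_sum]; linarith
    _ = ∏ k ∈ Finset.univ.filter (j < ·), Real.exp (-(5 * (4 / 5 : ℝ) ^ ((k : ℕ) - 2))) :=
        Real.exp_sum _ _
    _ ≤ _ := Finset.prod_le_prod (fun _ _ => (Real.exp_pos _).le) fun k hk => by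
        obtain ⟨h₁, h₂⟩ := hmem k hk
        have h₃ := sampleProb_le_geometric hn h₁ h₂
        have h₄ : (4 / 5 : ℝ) ^ ((k : ℕ) - 2) ≤ 4 / 5 :=
          pow_le_of_le_one (by norm_num) (by norm_num) (by omega)
        refine (Real.exp_le_exp.2 ?_).trans
          (exp_neg_le_one_sub (sampleProb n k).2.1 (h₃.trans h₄))
        linarith

lemma thinnedProb_le_one (j : Finset.Icc 1 (levels n)) : thinnedProb n j ≤ 1 := by
  refine mul_le_one₀ (sampleProb n j).2.2 (Finset.prod_nonneg fun k _ => ?_)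
    (Finset.prod_le_one (fun k _ => ?_) fun k _ => ?_)
  · exact sub_nonneg.2 (sampleProb n k).2.2
  · exact sub_nonneg.2 (sampleProb n k).2.2
  · exact sub_le_self _ (sampleProb n k).2.1

/-- The exponents `α_i = 1 - (3/4) ^ (h - i + 1)` satisfy `4 α_i = 1 + 3 α_{i+1}`. -/
lemma rho_pow_four (hn : 1 ≤ n) {i : ℕ} (hi : i < levels n) :
    rho n i ^ 4 = 2 * n * rho n (i + 1) ^ 3 := by
  have h2n : (0 : ℝ) < 2 * n := by positivity
  have h : (3 / 4 : ℝ) ^ (levels n + 1 - i) = 3 / 4 * (3 / 4 : ℝ) ^ (levels n + 1 - (i + 1)) := by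
    rw [← pow_succ']; congr 1; omega
  rw [rho, rho, h, ← Real.rpow_mul_natCast h2n.le, ← Real.rpow_mul_natCast h2n.le,
    ← Real.rpow_one_add' h2n.le]
  · congr 1; push_cast; ring
  · have : (3 / 4 : ℝ) ^ (levels n + 1 - (i + 1)) ≤ 1 := pow_le_one₀ (by norm_num) (by norm_num)
    push_cast
    rw [Nat.add_sub_add_right] at this
    linarith

lemma rho_levels_pow_four (hn : 1 ≤ n) : rho n (levels n) ^ 4 = 2 * n := by
  have h2n : (0 : ℝ) < 2 * n := by positivity
  rw [rho, ← Real.rpow_mul_natCast h2n.le]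
  norm_num

lemma rho_pos (hn : 1 ≤ n) (i : ℕ) : 0 < rho n i := Real.rpow_pos_of_pos (by positivity) _

lemma mul_sampleProb_le (hn : 1 ≤ n) (i : ℕ) : n * (sampleProb n i : ℝ) ≤ rho n i := by
  have : (0 : ℝ) < n := by exact_mod_cast hn
  rw [sampleProb_eq hn]
  calc n * min 1 (rho n i / n) ≤ n * (rho n i / n) := by gcongr; exact min_le_right _ _
    _ = rho n i := by field_simp

/-- The relation between the sampling probabilities of consecutive levels that makes the expected
number of clusters linear. -/
lemma mul_sampleProb_pow_le (hn : 1 ≤ n) {i : ℕ} (hi : i < levels n) :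
    n * (sampleProb n i : ℝ) ^ 4 ≤ 2 * n * (sampleProb n (i + 1) : ℝ) ^ 3 := by
  have hn' : (0 : ℝ) < n := by exact_mod_cast hn
  have hp₀ : 0 ≤ (sampleProb n i : ℝ) := (sampleProb n i).2.1
  have hp₁ : (sampleProb n i : ℝ) ≤ 1 := (sampleProb n i).2.2
  rcases min_choice 1 (rho n (i + 1) / n) with h | h
  · rw [sampleProb_eq hn (i + 1), h]
    nlinarith [pow_le_one₀ (n := 4) hp₀ hp₁]
  · rw [sampleProb_eq hn (i + 1), h]
    have h₁ : (n * (sampleProb n i : ℝ)) ^ 4 ≤ 2 * n * rho n (i + 1) ^ 3 :=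
      (pow_le_pow_left₀ (by positivity) (mul_sampleProb_le hn i) 4).trans_eq (rho_pow_four hn hi)
    rw [div_pow, ← mul_div_assoc, le_div_iff₀ (by positivity)]
    calc _ = (n * (sampleProb n i : ℝ)) ^ 4 := by ring
      _ ≤ _ := h₁

lemma sampling_landmarks_one (hn : 3 ≤ n) : ∀ᵐ S ∂sampling n, landmarks S 1 = Set.univ := by
  have h1 : 1 ∈ Finset.Icc 1 (levels n) := Finset.mem_Icc.2 ⟨le_rfl, levels_pos hn⟩
  have h := sampling_real_subset (Finset.univ : Finset (Fin n)) ⟨1, h1⟩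
  rw [sampleProb_one hn, one_pow, measureReal_def, ENNReal.toReal_eq_one_iff] at h
  filter_upwards [(mem_ae_iff_prob_eq_one (Set.Finite.measurableSet (Set.toFinite _))).2 h] with S hS
  rw [landmarks, dif_pos h1]
  exact Set.eq_univ_of_forall fun v => hS v (Finset.mem_univ v)

end Probabilities

/-! ### The expected number of clusters -/

section Expectation

variable {n : ℕ} {G : SimpleGraph (Fin n)} {ω : Sym2 (Fin n) → ℝ≥0}

lemma pow_le_max_pow {r : ℝ} (hr : 0 ≤ r) {k m : ℕ} (hk : k ≤ m) : r ^ k ≤ max 1 r ^ m :=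
  (pow_le_pow_left₀ hr (le_max_right _ _) k).trans (pow_le_pow_right₀ (le_max_left _ _) hk)

/-- Summing the bounds for the events `A ⊆ L_i` and `L_{i+1} ∩ D = ∅` over all potential clusters
around `u`. -/
lemma sum_cluster_weights_le (d : Fin n → ℝ≥0∞) (u : Fin n) {p x r : ℝ} (hp : 0 ≤ p) (hx₀ : 0 ≤ x)
    (hx₁ : x ≤ 1) (hr : 0 ≤ r)
    (hk : ∀ k, ∑ S ∈ (Finset.univ : Finset (Fin n)).powersetCard k,
      p ^ k * x ^ (Finset.univ.filter fun w => ∃ s ∈ S, d w ≤ d s).card ≤ r ^ k) :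
    ∑ f : Fin 3 → Fin n, p ^ (insert u (Finset.univ.image f)).card *
      x ^ (Finset.univ.filter fun w => ∃ k, d w ≤ d (f k)).card ≤ 256 * p * max 1 r ^ 3 := by
  classical
  have h₁ : ∀ f : Fin 3 → Fin n, p ^ (insert u (Finset.univ.image f)).card *
      x ^ (Finset.univ.filter fun w => ∃ k, d w ≤ d (f k)).card ≤
      p * (p ^ ((Finset.univ.image f).erase u).card * x ^ (Finset.univ.filter fun w =>
        ∃ s ∈ (Finset.univ.image f).erase u, d w ≤ d s).card) := fun f => by
    have hins : insert u (Finset.univ.image f) = insert u ((Finset.univ.image f).erase u) := by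
      ext w; by_cases hw : w = u <;> simp [hw]
    rw [hins, Finset.card_insert_of_notMem (Finset.notMem_erase _ _),
      pow_succ', mul_assoc]
    refine mul_le_mul_of_nonneg_left (mul_le_mul_of_nonneg_left ?_ (by positivity)) hp
    refine pow_le_pow_of_le_one hx₀ hx₁ (Finset.card_le_card fun w hw => ?_)
    simp only [Finset.mem_filter, Finset.mem_univ, true_and, Finset.mem_erase, Finset.mem_image]
      at hw ⊢
    obtain ⟨s, ⟨-, k, rfl⟩, hs⟩ := hw
    exact ⟨k, hs⟩
  refine (Finset.sum_le_sum fun f _ => h₁ f).trans ?_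
  rw [← Finset.mul_sum]
  refine (mul_le_mul_of_nonneg_left (sum_triples_le u (F := fun S => p ^ S.card *
    x ^ (Finset.univ.filter fun w => ∃ s ∈ S, d w ≤ d s).card) fun S => by positivity) hp).trans ?_
  have h₂ : ∀ k ∈ Finset.range 4, ∑ S ∈ (Finset.univ : Finset (Fin n)).powersetCard k,
      p ^ S.card * x ^ (Finset.univ.filter fun w => ∃ s ∈ S, d w ≤ d s).card ≤ max 1 r ^ 3 :=
    fun k hk' => by
      refine le_trans (le_of_eq ?_) ((hk k).trans
        (pow_le_max_pow hr (by simp at hk'; omega)))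
      exact Finset.sum_congr rfl fun S hS => by rw [(Finset.mem_powersetCard.1 hS).2]
  have h₃ := Finset.sum_le_card_nsmul _ _ _ h₂
  rw [Finset.card_range, nsmul_eq_mul] at h₃
  push_cast at h₃
  calc _ ≤ p * (64 * (4 * max 1 r ^ 3)) := by gcongr
    _ = 256 * p * max 1 r ^ 3 := by ring

lemma landmarks_eq {i : ℕ} (hi : i ∈ Finset.Icc 1 (levels n)) (S : Sample n) :
    landmarks S i = S ⟨i, hi⟩ := dif_pos hi

/-- A vertex that belongs to the sampled set of level `j` but to none of a higher level is a
landmark of level `j` also after the sets have been made disjoint. -/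
lemma mem_disjointLandmarks {S : Sample n} {j : Finset.Icc 1 (levels n)} (hj : 2 ≤ (j : ℕ))
    {v : Fin n} (hv : v ∈ S j) (hv' : ∀ k, j < k → v ∉ S k) : v ∈ disjointLandmarks S j := by
  rw [disjointLandmarks, if_neg (by omega), landmarks_eq j.2]
  refine ⟨hv, fun h => ?_⟩
  obtain ⟨k, hk, hvk⟩ := by simpa using h
  by_cases hkm : k ∈ Finset.Icc 1 (levels n)
  · rw [landmarks_eq hkm] at hvk
    exact hv' ⟨k, hkm⟩ hk hvk
  · simp [landmarks, hkm] at hvk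

/-- The constant in the bound for the expected number of clusters: `256` from the sum over the
clusters around a vertex, `2` from the relation between consecutive levels, and the cube of the
factor lost when the landmark sets are made disjoint. -/
noncomputable def clusterConst : ℝ := 512 * Real.exp 75

lemma clusterConst_nonneg : 0 ≤ clusterConst := by unfold clusterConst; positivity

/-- The expected number of clusters of each level is linear. The landmark sets of level `i` may be
any subsets of the sampled ones, those of level `i + 1` have to contain the thinned ones. -/
lemma lintegral_card_clusters_le (hn : 3 ≤ n) {L : Sample n → ℕ → Set (Fin n)}
    (hL : ∀ S i, L S i ⊆ landmarks S i) (hL' : ∀ S i, disjointLandmarks S i ⊆ L S i) {i : ℕ}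
    (hi : i ∈ Finset.Icc 1 (levels n)) :
    ∫⁻ S, ((clusters G ω (levels n) (L S) i).card : ℝ≥0∞) ∂sampling n ≤
      ENNReal.ofReal (clusterConst * n) := by
  classical
  obtain ⟨hi₁, hih⟩ := Finset.mem_Icc.1 hi
  have hn₁ : 1 ≤ n := by omega
  have hn₀ : (0 : ℝ) < n := by positivity
  set p : ℝ := (sampleProb n i : ℝ) with hp
  have hp₀ : 0 ≤ p := (sampleProb n i).2.1
  have hp₁ : p ≤ 1 := (sampleProb n i).2.2
  -- It suffices to bound the probability that a fixed tuple is a cluster.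
  have hreduce : ∀ (W : Fin n × (Fin 3 → Fin n) → ℝ), (∀ c, 0 ≤ W c) →
      (∀ c, (sampling n).real {S | c ∈ clusters G ω (levels n) (L S) i} ≤ W c) →
      (∑ c, W c ≤ clusterConst * n) →
      ∫⁻ S, ((clusters G ω (levels n) (L S) i).card : ℝ≥0∞) ∂sampling n ≤
        ENNReal.ofReal (clusterConst * n) := by
    intro W hW₀ hW hsum
    have hcard : ∀ S : Sample n, ((clusters G ω (levels n) (L S) i).card : ℝ≥0∞) =
        ∑ c, {S | c ∈ clusters G ω (levels n) (L S) i}.indicator 1 S := fun S => by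
      simp only [Set.indicator_apply, Set.mem_ofPred_eq, Pi.one_apply, Finset.sum_ite_mem,
        Finset.univ_inter, Finset.sum_const, nsmul_eq_mul, mul_one]
    simp_rw [hcard]
    rw [lintegral_finsetSum _ fun c _ => measurable_of_finite _]
    refine le_trans ?_ (ENNReal.ofReal_le_ofReal hsum)
    rw [ENNReal.ofReal_sum_of_nonneg fun c _ => hW₀ c]
    refine Finset.sum_le_sum fun c _ => ?_
    rw [lintegral_indicator_one (Set.Finite.measurableSet (Set.toFinite _)), ← ofReal_measureReal]
    exact ENNReal.ofReal_le_ofReal (hW c)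
  have hmemA : ∀ {S : Sample n} {c : Fin n × (Fin 3 → Fin n)},
      c ∈ clusters G ω (levels n) (L S) i →
      ∀ v ∈ insert c.1 (Finset.univ.image c.2), v ∈ S ⟨i, hi⟩ := by
    intro S c hc v hv
    obtain ⟨h₁, h₂⟩ := (Finset.mem_filter.1 hc).2
    rw [← landmarks_eq hi S]
    refine hL S i ?_
    rcases Finset.mem_insert.1 hv with rfl | hv
    · exact h₁
    · obtain ⟨k, -, rfl⟩ := Finset.mem_image.1 hv
      exact (h₂ k).1
  rcases hih.eq_or_lt with htop | hlt
  · -- the top level, where the bound is the fourth moment of the number of landmarks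
    refine hreduce (fun c => p ^ (insert c.1 (Finset.univ.image c.2)).card) (fun c => by positivity)
      (fun c => ?_) ?_
    · rw [hp, ← sampling_real_subset _ ⟨i, hi⟩]
      exact measureReal_mono fun S hS => hmemA hS
    · rw [Fintype.sum_prod_type]
      have hr₁ : max 1 (n * p) ^ 3 * (n * p) ≤ 2 * n := by
        have hρ := rho_levels_pow_four hn₁
        have hle : n * p ≤ rho n (levels n) := by
          rw [← htop]; exact mul_sampleProb_le hn₁ i
        have h1 : 1 ≤ rho n (levels n) := by
          by_contra! h
          have := pow_le_one₀ (n := 4) (rho_pos hn₁ _).le h.le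
          rw [hρ] at this
          have : (1 : ℝ) ≤ n := by exact_mod_cast hn₁
          linarith
        calc max 1 ((n : ℝ) * p) ^ 3 * ((n : ℝ) * p) ≤ rho n (levels n) ^ 3 * rho n (levels n) := by
              gcongr; exact max_le h1 hle
          _ = 2 * (n : ℝ) := by rw [← hρ]; ring
      have hu : ∀ u : Fin n, ∑ f : Fin 3 → Fin n, p ^ (insert u (Finset.univ.image f)).card ≤
          256 * p * max 1 (n * p) ^ 3 := fun u => by
        have := sum_cluster_weights_le (fun _ : Fin n => 0) u hp₀ zero_le_one le_rfl
          (r := n * p) (by positivity) fun k => by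
            simp only [one_pow, mul_one, Finset.sum_const, Finset.card_powersetCard,
              Finset.card_univ, Fintype.card_fin, nsmul_eq_mul, mul_pow]
            gcongr
            exact_mod_cast Nat.choose_le_pow n k
        simpa using this
      refine (Finset.sum_le_sum fun u _ => hu u).trans ?_
      rw [Finset.sum_const, Finset.card_univ, Fintype.card_fin, nsmul_eq_mul, clusterConst]
      have : (1 : ℝ) ≤ Real.exp 75 := Real.one_le_exp (by norm_num)
      nlinarith
  · have hj : i + 1 ∈ Finset.Icc 1 (levels n) := Finset.mem_Icc.2 ⟨by omega, hlt⟩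
    set j : Finset.Icc 1 (levels n) := ⟨i + 1, hj⟩ with hjdef
    set q := thinnedProb n j with hq
    have hq₁ : q ≤ 1 := thinnedProb_le_one j
    have hqle : Real.exp (-25) * sampleProb n (i + 1) ≤ q := le_thinnedProb hn j (by simp [hjdef]; omega)
    have hs₀ : 0 < (sampleProb n (i + 1) : ℝ) := by
      rw [sampleProb_eq hn₁]
      exact lt_min one_pos (div_pos (rho_pos hn₁ _) hn₀)
    have hq₀ : 0 < q := lt_of_lt_of_le (by positivity) hqle
    let D : Fin n × (Fin 3 → Fin n) → Finset (Fin n) := fun c =>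
      Finset.univ.filter fun w => ∃ k, wdist G ω c.1 w ≤ wdist G ω c.1 (c.2 k)
    refine hreduce (fun c => p ^ (insert c.1 (Finset.univ.image c.2)).card * (1 - q) ^ (D c).card)
      (fun c => ?_) (fun c => ?_) ?_
    · have : 0 ≤ 1 - q := sub_nonneg.2 hq₁
      positivity
    · rw [hp, hq, ← sampling_real_subset_and _ _ (i := ⟨i, hi⟩) (j := j)
        (by rw [hjdef, Subtype.mk_lt_mk]; omega)]
      refine measureReal_mono fun S hS => ⟨hmemA hS, fun v hv hvj => ?_⟩
      obtain ⟨k, hk⟩ := (Finset.mem_filter.1 hv).2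
      have hball := ((Finset.mem_filter.1 hS).2.2 k).2 hlt
      refine absurd (hk.trans_lt hball) (not_lt.2 (radius_le (hL' S _ ?_) _))
      exact mem_disjointLandmarks (j := j) (by simp [hjdef]; omega) hvj.1 hvj.2
    · rw [Fintype.sum_prod_type]
      have hu : ∀ u : Fin n, ∑ f : Fin 3 → Fin n, p ^ (insert u (Finset.univ.image f)).card *
          (1 - q) ^ (D (u, f)).card ≤ 256 * p * max 1 (p * q⁻¹) ^ 3 := fun u => by
        refine sum_cluster_weights_le (wdist G ω u) u hp₀ (sub_nonneg.2 hq₁) (by linarith)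
          (by positivity) fun k => ?_
        rw [← Finset.mul_sum, mul_pow]
        gcongr
        have := sum_powersetCard_le (wdist G ω u) (sub_nonneg.2 hq₁) (by linarith)
          (Finset.univ : Finset (Fin n)) k
        rw [sub_sub_cancel] at this
        exact le_trans (Finset.sum_congr rfl fun S _ => by congr!).le this
      refine (Finset.sum_le_sum fun u _ => hu u).trans ?_
      rw [Finset.sum_const, Finset.card_univ, Fintype.card_fin, nsmul_eq_mul, clusterConst]
      have hmain : n * p * max 1 (p * q⁻¹) ^ 3 ≤ 2 * n * Real.exp 75 := by
        rcases max_choice 1 (p * q⁻¹) with h | h <;> rw [h]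
        · have : (1 : ℝ) ≤ Real.exp 75 := Real.one_le_exp (by norm_num)
          nlinarith
        · have h₁ := mul_sampleProb_pow_le hn₁ hlt
          have h₂ : (sampleProb n (i + 1) : ℝ) ^ 3 ≤ Real.exp 75 * q ^ 3 := by
            have := pow_le_pow_left₀ (by positivity) hqle 3
            rw [mul_pow, ← Real.exp_nat_mul] at this
            calc (sampleProb n (i + 1) : ℝ) ^ 3
                = Real.exp 75 * (Real.exp ((3 : ℕ) * -25) * (sampleProb n (i + 1) : ℝ) ^ 3) := by
                  rw [← mul_assoc, ← Real.exp_add]; norm_num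
              _ ≤ _ := by gcongr
          calc n * p * (p * q⁻¹) ^ 3 = n * p ^ 4 / q ^ 3 := by field_simp
            _ ≤ 2 * n * (Real.exp 75 * q ^ 3) / q ^ 3 := by
                refine div_le_div_of_nonneg_right (h₁.trans ?_) (by positivity)
                gcongr
            _ = 2 * n * Real.exp 75 := by field_simp
      nlinarith

/-- The expected space is `O(n h)`. -/
lemma lintegral_space_le (hn : 3 ≤ n) (hω : ∀ e ∈ G.edgeSet, 0 < ω e)
    {L : Sample n → ℕ → Set (Fin n)} (hL : ∀ S i, L S i ⊆ landmarks S i)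
    (hL' : ∀ S i, disjointLandmarks S i ⊆ L S i) (O : ∀ S, Oracle G ω (levels n) (L S)) :
    ∫⁻ S, ((O S).memory.space : ℝ≥0∞) ∂sampling n ≤
      ENNReal.ofReal ((30 + 180 * clusterConst) * n * levels n) := by
  have hC := clusterConst_nonneg
  calc ∫⁻ S, ((O S).memory.space : ℝ≥0∞) ∂sampling n
      ≤ ∫⁻ S, ∑ i ∈ Finset.Icc 1 (levels n),
          (30 * (n : ℝ≥0∞) + 180 * (clusters G ω (levels n) (L S) i).card) ∂sampling n :=
        lintegral_mono fun S => by
          refine (Nat.cast_le.2 ((O S).space_le hω)).trans_eq ?_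
          push_cast; rfl
    _ = ∑ i ∈ Finset.Icc 1 (levels n), (30 * (n : ℝ≥0∞) +
          180 * ∫⁻ S, ((clusters G ω (levels n) (L S) i).card : ℝ≥0∞) ∂sampling n) := by
        rw [lintegral_finsetSum _ fun i _ => measurable_of_finite _]
        refine Finset.sum_congr rfl fun i _ => ?_
        rw [lintegral_add_left measurable_const, lintegral_const, measure_univ, mul_one,
          lintegral_const_mul _ (measurable_of_finite _)]
    _ ≤ ∑ i ∈ Finset.Icc 1 (levels n), ENNReal.ofReal ((30 + 180 * clusterConst) * n) := by
        refine Finset.sum_le_sum fun i hi => ?_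
        refine (add_le_add_right (mul_le_mul_right (lintegral_card_clusters_le hn hL hL' hi) _)
          _).trans_eq ?_
        rw [show (30 : ℝ≥0∞) = ENNReal.ofReal 30 by simp, show (180 : ℝ≥0∞) = ENNReal.ofReal 180 by simp,
          ← ENNReal.ofReal_natCast, ← ENNReal.ofReal_mul (by norm_num),
          ← ENNReal.ofReal_mul (by norm_num), ← ENNReal.ofReal_add (by positivity) (by positivity)]
        congr 1; ring
    _ = ENNReal.ofReal ((30 + 180 * clusterConst) * n * levels n) := by
        rw [Finset.sum_const, Nat.card_Icc, Nat.add_sub_cancel, nsmul_eq_mul, mul_comm,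
          ← ENNReal.ofReal_natCast, ← ENNReal.ofReal_mul (by positivity)]

lemma disjointLandmarks_subset (S : Sample n) (i : ℕ) : disjointLandmarks S i ⊆ landmarks S i := by
  rw [disjointLandmarks]
  split_ifs with h
  · rw [h]
  · exact Set.sdiff_subset

end Expectation

/-! ### Table lookups -/

section Lookup

variable {n : ℕ} {G : SimpleGraph (Fin n)} {ω : Sym2 (Fin n) → ℝ≥0} {h : ℕ} {L : ℕ → Set (Fin n)}

/-- Keys are unique, so a lookup is independent of the choice of a record. -/
lemma Oracle.eq_of_key_eq (O : Oracle G ω h L) {e e' : Entry} (he : e ∈ O.memory)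
    (he' : e' ∈ O.memory) (hk : e.key = e'.key) : e = e' := by
  classical
  obtain ⟨i, -, he⟩ := O.mem_memory_iff.1 he
  obtain ⟨i', -, he'⟩ := O.mem_memory_iff.1 he'
  rcases he with he | he | he | he <;> rcases he' with he' | he' | he' | he' <;>
    obtain ⟨x, -, rfl⟩ := Finset.mem_image.1 he <;>
    obtain ⟨x', -, rfl⟩ := Finset.mem_image.1 he' <;>
    simp only [List.cons.injEq, and_true, true_and, reduceCtorEq, false_and, and_false,
      OfNat.ofNat_ne_zero, OfNat.zero_ne_ofNat, zero_ne_one, one_ne_zero, OfNat.ofNat_ne_one,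
      OfNat.one_ne_ofNat, Nat.reduceEqDiff, Fin.val_inj] at hk
  · obtain ⟨rfl, rfl⟩ := hk; rfl
  · obtain ⟨rfl, h₁, h₂⟩ := hk
    obtain rfl : x = x' := Prod.ext h₁ h₂
    rfl
  · obtain ⟨rfl, rfl⟩ := hk; rfl
  · obtain ⟨rfl, h₁, h₂, h₃, h₄, h₅⟩ := hk
    obtain rfl : x = x' := Prod.ext (Prod.ext h₁ h₂) (Prod.ext (Prod.ext h₃ h₄) h₅)
    rfl

lemma Oracle.lookup_eq_some (O : Oracle G ω h L) {e : Entry} (he : e ∈ O.memory) :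
    O.memory.lookup e.key = some e := by
  have hex : ∃ e' ∈ O.memory, e'.key = e.key := ⟨e, he, rfl⟩
  rw [Memory.lookup, dif_pos hex]
  exact congrArg some (O.eq_of_key_eq hex.choose_spec.1 he hex.choose_spec.2)

lemma Memory.lookup_eq_none {M : Memory} {k : List ℕ} (hk : ∀ e ∈ M, e.key ≠ k) :
    M.lookup k = none :=
  dif_neg fun ⟨e, he, h⟩ => hk e he h

variable (O : Oracle G ω h L) {i : ℕ}

lemma Oracle.lookup_tree (hi : 1 ≤ i ∧ i ≤ h) {v : Fin n} (hv : radius G ω (L i) v ≠ ⊤) :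
    O.memory.lookup [0, i, v] = some ⟨[0, i, v], [(O.forest i).parent v],
      [edgeWt G ω v (some ((O.forest i).parent v))]⟩ := by
  classical
  exact O.lookup_eq_some (e := ⟨[0, i, v], _, _⟩) (O.mem_memory_iff.2 ⟨i, hi, .inl
    (Finset.mem_image.2 ⟨v, Finset.mem_filter.2 ⟨Finset.mem_univ _, hv⟩, rfl⟩)⟩)

lemma Oracle.lookup_pair (hi : 1 ≤ i ∧ i ≤ h) {u v : Fin n} (ha : (u, v) ∈ landmarkPairs G ω h L i) :
    O.memory.lookup [1, i, u, v] = some ⟨[1, i, u, v],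
      [code (succIn ((O.dppro i).path (u, v)) u), code (predIn ((O.dppro i).path (u, v)) v)],
      [edgeWt G ω u (succIn ((O.dppro i).path (u, v)) u),
        edgeWt G ω v (predIn ((O.dppro i).path (u, v)) v)]⟩ := by
  classical
  exact O.lookup_eq_some (e := ⟨[1, i, u, v], _, _⟩) (O.mem_memory_iff.2 ⟨i, hi, .inr (.inl
    (Finset.mem_image.2 ⟨(u, v), Finset.mem_filter.2 ⟨Finset.mem_univ _, ha⟩, rfl⟩))⟩)

lemma Oracle.lookup_home (hi : 1 ≤ i ∧ i ≤ h) {x : Fin n} (hx : (O.dppro i).IsInternal x) :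
    O.memory.lookup [2, i, x] = some ⟨[2, i, x],
      [((O.dppro i).home x).1, ((O.dppro i).home x).2,
        code (predIn ((O.dppro i).path ((O.dppro i).home x)) x),
        code (succIn ((O.dppro i).path ((O.dppro i).home x)) x)],
      [edgeWt G ω x (predIn ((O.dppro i).path ((O.dppro i).home x)) x),
        edgeWt G ω x (succIn ((O.dppro i).path ((O.dppro i).home x)) x)]⟩ := by
  classical
  exact O.lookup_eq_some (e := ⟨[2, i, x], _, _⟩) (O.mem_memory_iff.2 ⟨i, hi, .inr (.inr (.inl
    (Finset.mem_image.2 ⟨x, Finset.mem_filter.2 ⟨Finset.mem_univ _, hx⟩, rfl⟩)))⟩)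

lemma Oracle.lookup_branch (hi : 1 ≤ i ∧ i ≤ h) {a b : Fin n × Fin n} {x : Fin n}
    (hx : (O.dppro i).IsBranching a b x) :
    O.memory.lookup [3, i, a.1, a.2, b.1, b.2, x] = some ⟨[3, i, a.1, a.2, b.1, b.2, x],
      [code (predIn ((O.dppro i).path a) x), code (succIn ((O.dppro i).path a) x),
        code (predIn ((O.dppro i).path b) x), code (succIn ((O.dppro i).path b) x)],
      [edgeWt G ω x (predIn ((O.dppro i).path a) x), edgeWt G ω x (succIn ((O.dppro i).path a) x),
        edgeWt G ω x (predIn ((O.dppro i).path b) x),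
        edgeWt G ω x (succIn ((O.dppro i).path b) x)]⟩ := by
  classical
  exact O.lookup_eq_some (e := ⟨[3, i, a.1, a.2, b.1, b.2, x], _, _⟩) (O.mem_memory_iff.2
    ⟨i, hi, .inr (.inr (.inr
      (Finset.mem_image.2 ⟨(a, b, x), Finset.mem_filter.2 ⟨Finset.mem_univ _, hx⟩, rfl⟩)))⟩)

lemma Oracle.lookup_pair_eq_none {u v : Fin n} (ha : (u, v) ∉ landmarkPairs G ω h L i) :
    O.memory.lookup [1, i, u, v] = none := by
  classical
  refine Memory.lookup_eq_none fun e he hk => ?_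
  obtain ⟨i', -, he⟩ := O.mem_memory_iff.1 he
  rcases he with he | he | he | he <;> obtain ⟨x, hx, rfl⟩ := Finset.mem_image.1 he <;>
    simp [Fin.val_inj] at hk
  obtain ⟨rfl, h₁, h₂⟩ := hk
  obtain rfl : x = (u, v) := Prod.ext h₁ h₂
  exact ha (Finset.mem_filter.1 hx).2

lemma Oracle.lookup_branch_eq_none {a b : Fin n × Fin n} {x : Fin n}
    (hx : ¬ (O.dppro i).IsBranching a b x) :
    O.memory.lookup [3, i, a.1, a.2, b.1, b.2, x] = none := by
  classical
  refine Memory.lookup_eq_none fun e he hk => ?_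
  obtain ⟨i', -, he⟩ := O.mem_memory_iff.1 he
  rcases he with he | he | he | he <;> obtain ⟨y, hy, rfl⟩ := Finset.mem_image.1 he <;>
    simp [Fin.val_inj] at hk
  obtain ⟨rfl, h₁, h₂, h₃, h₄, h₅⟩ := hk
  obtain rfl : y = (a, b, x) := Prod.ext (Prod.ext h₁ h₂) (Prod.ext (Prod.ext h₃ h₄) h₅)
  exact hx (Finset.mem_filter.1 hy).2

end Lookup

/-! ### Climbing the trees -/

section Climb

variable {n : ℕ} {G : SimpleGraph (Fin n)} {ω : Sym2 (Fin n) → ℝ≥0}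

lemma edgeWt_adj {x y : Fin n} (h : G.Adj x y) : edgeWt G ω x (some y) = ω s(x, y) := if_pos h

lemma Forest.radius_eq {A : Set (Fin n)} (F : Forest G ω A) {v : Fin n}
    (hv : radius G ω A v ≠ ⊤) (h : F.near v ≠ v) :
    radius G ω A v = ω s(v, F.parent v) + radius G ω A (F.parent v) := by
  refine le_antisymm (radius_le_adj_add A (F.parent_adj v hv h)) ?_
  rw [← F.near_closest v hv, F.parent_dist v hv h]
  exact add_le_add_right (radius_le (F.near_mem v hv) _) _

/-- Induction from the roots of a forest to the leaves. -/
lemma Forest.induction (hω : ∀ e ∈ G.edgeSet, 0 < ω e) {A : Set (Fin n)} (F : Forest G ω A)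
    {motive : ∀ v, radius G ω A v ≠ ⊤ → Prop}
    (root : ∀ v hv, F.near v = v → F.parent v = v → motive v hv)
    (child : ∀ v hv (hp : radius G ω A (F.parent v) ≠ ⊤), F.near v ≠ v → G.Adj v (F.parent v) →
      F.near (F.parent v) = F.near v → motive (F.parent v) hp → motive v hv)
    (v : Fin n) (hv : radius G ω A v ≠ ⊤) : motive v hv := by
  have wf : WellFounded fun x y : Fin n => radius G ω A x < radius G ω A y :=
    Finite.wellFounded_of_trans_of_irrefl _
  induction v using wf.induction with
  | _ v ih =>
  by_cases h : F.near v = v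
  · exact root v hv h (F.parent_root v hv h)
  · have hadj := F.parent_adj v hv h
    have hr := F.radius_eq hv h
    have hp : radius G ω A (F.parent v) ≠ ⊤ := fun htop => hv (by rw [hr, htop]; simp)
    refine child v hv hp h hadj (F.parent_near v hv h) (ih _ ?_ hp)
    rw [hr, add_comm]
    exact ENNReal.lt_add_right hp (by exact_mod_cast (hω s(_, _) hadj).ne')

variable {h : ℕ} {L : ℕ → Set (Fin n)} (O : Oracle G ω h L) {i : ℕ}

/-- Climbing from `u` reports a shortest path from `u` to its closest landmark. -/
lemma exec_climbU (hω : ∀ e ∈ G.edgeSet, 0 < ω e) (hi : 1 ≤ i ∧ i ≤ h) {u : Fin n}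
    (hu : radius G ω (L i) u ≠ ⊤) {s : State} (hlev : s.reg .lev = i) (hsu : s.reg .u = u) :
    ∃ (t : ℕ) (s' : State) (w : G.Walk u ((O.forest i).near u)),
      Exec O.memory climbU s t s' ∧ t ≤ 8 + 11 * w.length ∧
      (walkWeight ω w : ℝ≥0∞) = radius G ω (L i) u ∧
      s'.reg .u = (O.forest i).near u ∧ s'.reg .lev = i ∧ s'.reg .v = s.reg .v ∧
      s'.reg .done = s.reg .done ∧ s'.stack = s.stack ∧
      s'.out = s.out ++ w.support.tail.map Fin.val ∧
      s'.wreg .total = s.wreg .total + walkWeight ω w := by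
  set F := O.forest i with hF
  have loop : ∀ u : Fin n, radius G ω (L i) u ≠ ⊤ → ∀ s : State, s.reg .lev = i → s.reg .u = u →
      s.reg .par = F.parent u → s.wreg .w1 = edgeWt G ω u (some (F.parent u)) →
      ∃ (t : ℕ) (s' : State) (w : G.Walk u (F.near u)),
        Exec O.memory (.while (.ne .par .u) (.block
       [.copy .u .par,
        .addWt .total .w1,
        .emit .u,
        .read 0 [.lev, .u] [.par] [.w1]])) s t s' ∧ t ≤ 1 + 11 * w.length ∧
        (walkWeight ω w : ℝ≥0∞) = radius G ω (L i) u ∧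
        s'.reg .u = F.near u ∧ s'.reg .lev = i ∧ s'.reg .v = s.reg .v ∧
        s'.reg .done = s.reg .done ∧ s'.stack = s.stack ∧
        s'.out = s.out ++ w.support.tail.map Fin.val ∧
        s'.wreg .total = s.wreg .total + walkWeight ω w := by
    intro u hu
    induction u, hu using F.induction hω with
    | root u hu hroot hpar =>
      intro s hlev hsu hsp _
      refine ⟨1, s, SimpleGraph.Walk.nil.copy rfl hroot.symm, .while_false ?_, ?_, ?_, ?_, hlev,
        rfl, rfl, rfl, ?_, ?_⟩
      · simp [Cond.Holds, hsp, hsu, hpar]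
      · simp
      · have h0 := F.near_closest u hu
        rw [hroot, wdist_self] at h0
        rw [← h0]
        simp [walkWeight]
      · rw [hsu, hroot]
      · simp
      · simp [walkWeight]
    | child u hu hpu hne hadj hnear ih =>
      intro s hlev hsu hsp hsw
      have hlook := O.lookup_tree hi hpu
      rw [← hF] at hlook
      obtain ⟨t, s', w, hex, ht, hw, h₁, h₂, h₃, h₄, h₅, h₆, h₇⟩ :=
        ih { reg := Function.update (assign (Function.update s.reg .u (s.reg .par)) [.par]
              [(F.parent (F.parent u) : ℕ)]) .found 1
             wreg := assign (Function.update s.wreg .total (s.wreg .total + s.wreg .w1)) [.w1]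
              [edgeWt G ω (F.parent u) (some (F.parent (F.parent u)))]
             stack := s.stack
             out := s.out ++ [s.reg .par] }
          (by simp [assign, hlev]) (by simp [assign, hsp]) (by simp [assign]) (by simp [assign])
      refine ⟨1 + (1 + (1 + (1 + (6 + 1)))) + t, s',
        (SimpleGraph.Walk.cons hadj w).copy rfl hnear, ?_, ?_, ?_, ?_, h₂, ?_, ?_, h₅, ?_, ?_⟩
      · refine .while_true ?_ ?_ hex
        · simpa [Cond.Holds, hsp, hsu, Fin.val_inj] using hadj.ne'
        · refine .seq (.copy _ _ _) (.seq (.addWt _ _ _) (.seq (.emit _ _) (.seq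
            (.read_found _ 0 [.lev, .u] [.par] [.w1]
              ⟨[0, i, F.parent u], [(F.parent (F.parent u) : ℕ)],
                [edgeWt G ω (F.parent u) (some (F.parent (F.parent u)))]⟩ ?_) ?_)))
          · simpa [hlev, hsp] using hlook
          · simp only [hsp, Function.update_self]
            exact .skip _
      · simp only [SimpleGraph.Walk.length_copy, SimpleGraph.Walk.length_cons]; omega
      · rw [F.radius_eq hu hne, ← hw, ← ENNReal.coe_add, ← walkWeight_cons ω hadj w]
        simp [walkWeight]
      · rw [h₁, hnear]
      · simp [h₃, assign]
      · simp [h₄, assign]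
      · simp only [SimpleGraph.Walk.support_copy, SimpleGraph.Walk.support_cons, List.tail_cons]
        rw [h₆, hsp, List.append_assoc]
        exact congrArg (s.out ++ ·) (congrArg (List.map Fin.val) w.cons_tail_support)
      · have : walkWeight ω ((SimpleGraph.Walk.cons hadj w).copy rfl hnear) =
            walkWeight ω (SimpleGraph.Walk.cons hadj w) := by simp [walkWeight]
        rw [this, h₇, walkWeight_cons, ← edgeWt_adj (ω := ω) hadj, ← hsw]
        simp [assign, add_assoc]
  obtain ⟨t, s', w, hex, ht, hw, h₁, h₂, h₃, h₄, h₅, h₆, h₇⟩ := loop u hu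
    { s with
      reg := Function.update (assign s.reg [.par] [(F.parent u : ℕ)]) .found 1
      wreg := assign s.wreg [.w1] [edgeWt G ω u (some (F.parent u))] }
    (by simp [assign, hlev]) (by simp [assign, hsu]) (by simp [assign]) (by simp [assign])
  refine ⟨6 + (t + 1), s', w, .seq (.read_found _ 0 [.lev, .u] [.par] [.w1]
      ⟨[0, i, u], [(F.parent u : ℕ)], [edgeWt G ω u (some (F.parent u))]⟩ ?_)
      (.seq hex (.skip _)), by omega, hw, h₁, h₂, ?_, ?_, h₅, h₆, ?_⟩
  · simpa [hlev, hsu] using O.lookup_tree hi hu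
  · simp [h₃, assign]
  · simp [h₄, assign]
  · simp [h₇, assign]

/-- Climbing from `v` puts the reverse of a shortest path from `v` to its closest landmark on the
stack. -/
lemma exec_climbV (hω : ∀ e ∈ G.edgeSet, 0 < ω e) (hi : 1 ≤ i ∧ i ≤ h) {v : Fin n}
    (hv : radius G ω (L i) v ≠ ⊤) {s : State} (hlev : s.reg .lev = i) (hsv : s.reg .v = v) :
    ∃ (t : ℕ) (s' : State) (w : G.Walk v ((O.forest i).near v)),
      Exec O.memory climbV s t s' ∧ t ≤ 8 + 11 * w.length ∧
      (walkWeight ω w : ℝ≥0∞) = radius G ω (L i) v ∧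
      s'.reg .v = (O.forest i).near v ∧ s'.reg .lev = i ∧ s'.reg .u = s.reg .u ∧
      s'.reg .done = s.reg .done ∧
      s'.stack = w.reverse.support.tail.map Fin.val ++ s.stack ∧
      s'.out = s.out ∧ s'.wreg .total = s.wreg .total + walkWeight ω w := by
  set F := O.forest i with hF
  have loop : ∀ v : Fin n, radius G ω (L i) v ≠ ⊤ → ∀ s : State, s.reg .lev = i → s.reg .v = v →
      s.reg .par = F.parent v → s.wreg .w1 = edgeWt G ω v (some (F.parent v)) →
      ∃ (t : ℕ) (s' : State) (w : G.Walk v (F.near v)),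
        Exec O.memory (.while (.ne .par .v) (.block
       [.push .v,
        .copy .v .par,
        .addWt .total .w1,
        .read 0 [.lev, .v] [.par] [.w1]])) s t s' ∧ t ≤ 1 + 11 * w.length ∧
        (walkWeight ω w : ℝ≥0∞) = radius G ω (L i) v ∧
        s'.reg .v = F.near v ∧ s'.reg .lev = i ∧ s'.reg .u = s.reg .u ∧
        s'.reg .done = s.reg .done ∧
        s'.stack = w.reverse.support.tail.map Fin.val ++ s.stack ∧
        s'.out = s.out ∧ s'.wreg .total = s.wreg .total + walkWeight ω w := by
    intro v hv
    induction v, hv using F.induction hω with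
    | root v hv hroot hpar =>
      intro s hlev hsv hsp _
      refine ⟨1, s, SimpleGraph.Walk.nil.copy rfl hroot.symm, .while_false ?_, ?_, ?_, ?_, hlev,
        rfl, rfl, ?_, rfl, ?_⟩
      · simp [Cond.Holds, hsp, hsv, hpar]
      · simp
      · have h0 := F.near_closest v hv
        rw [hroot, wdist_self] at h0
        rw [← h0]
        simp [walkWeight]
      · rw [hsv, hroot]
      · simp
      · simp [walkWeight]
    | child v hv hpv hne hadj hnear ih =>
      intro s hlev hsv hsp hsw
      have hlook := O.lookup_tree hi hpv
      rw [← hF] at hlook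
      obtain ⟨t, s', w, hex, ht, hw, h₁, h₂, h₃, h₄, h₅, h₆, h₇⟩ :=
        ih { reg := Function.update (assign (Function.update s.reg .v (s.reg .par)) [.par]
              [(F.parent (F.parent v) : ℕ)]) .found 1
             wreg := assign (Function.update s.wreg .total (s.wreg .total + s.wreg .w1)) [.w1]
              [edgeWt G ω (F.parent v) (some (F.parent (F.parent v)))]
             stack := s.reg .v :: s.stack
             out := s.out }
          (by simp [assign, hlev]) (by simp [assign, hsp]) (by simp [assign]) (by simp [assign])
      refine ⟨1 + (1 + (1 + (1 + (6 + 1)))) + t, s',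
        (SimpleGraph.Walk.cons hadj w).copy rfl hnear, ?_, ?_, ?_, ?_, h₂, ?_, ?_, ?_, h₆, ?_⟩
      · refine .while_true ?_ ?_ hex
        · simpa [Cond.Holds, hsp, hsv, Fin.val_inj] using hadj.ne'
        · refine .seq (.push _ _) (.seq (.copy _ _ _) (.seq (.addWt _ _ _) (.seq
            (.read_found _ 0 [.lev, .v] [.par] [.w1]
              ⟨[0, i, F.parent v], [(F.parent (F.parent v) : ℕ)],
                [edgeWt G ω (F.parent v) (some (F.parent (F.parent v)))]⟩ ?_) (.skip _))))
          simpa [hlev, hsp] using hlook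
      · simp only [SimpleGraph.Walk.length_copy, SimpleGraph.Walk.length_cons]; omega
      · rw [F.radius_eq hv hne, ← hw, ← ENNReal.coe_add, ← walkWeight_cons ω hadj w]
        simp [walkWeight]
      · rw [h₁, hnear]
      · simp [h₃, assign]
      · simp [h₄, assign]
      · simp only [SimpleGraph.Walk.reverse_copy, SimpleGraph.Walk.support_copy,
          SimpleGraph.Walk.reverse_cons, SimpleGraph.Walk.tail_support_append]
        rw [h₅]
        simp [hsv]
      · have : walkWeight ω ((SimpleGraph.Walk.cons hadj w).copy rfl hnear) =
            walkWeight ω (SimpleGraph.Walk.cons hadj w) := by simp [walkWeight]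
        rw [this, h₇, walkWeight_cons, ← edgeWt_adj (ω := ω) hadj, ← hsw]
        simp [assign, add_assoc]
  obtain ⟨t, s', w, hex, ht, hw, h₁, h₂, h₃, h₄, h₅, h₆, h₇⟩ := loop v hv
    { s with
      reg := Function.update (assign s.reg [.par] [(F.parent v : ℕ)]) .found 1
      wreg := assign s.wreg [.w1] [edgeWt G ω v (some (F.parent v))] }
    (by simp [assign, hlev]) (by simp [assign, hsv]) (by simp [assign]) (by simp [assign])
  refine ⟨6 + (t + 1), s', w, .seq (.read_found _ 0 [.lev, .v] [.par] [.w1]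
      ⟨[0, i, v], [(F.parent v : ℕ)], [edgeWt G ω v (some (F.parent v))]⟩ ?_)
      (.seq hex (.skip _)), by omega, hw, h₁, h₂, ?_, ?_, h₅, h₆, ?_⟩
  · simpa [hlev, hsv] using O.lookup_tree hi hv
  · simp [h₃, assign]
  · simp [h₄, assign]
  · simp [h₇, assign]

end Climb

/-! ### Following a stored path -/

section Follow

variable {n : ℕ} {G : SimpleGraph (Fin n)} {ω : Sym2 (Fin n) → ℝ≥0} {h : ℕ} {L : ℕ → Set (Fin n)}
  (O : Oracle G ω h L) {i : ℕ}

@[simp] lemma code_some (x : Fin n) : code (some x) = (x : ℕ) := rfl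

/-- An internal vertex of a path has two different neighbours on it. -/
lemma exists_predIn_succIn {l : List (Fin n)} {u v x : Fin n} (hl : l.Nodup)
    (hu : l.head? = some u) (hv : l.getLast? = some v) (hx : x ∈ l) (hxu : x ≠ u) (hxv : x ≠ v) :
    ∃ y z : Fin n, y ≠ z ∧ predIn l x = some y ∧ succIn l x = some z := by
  obtain ⟨s, t, rfl⟩ := List.append_of_mem hx
  have hd := List.nodup_append.1 hl
  have hxs : x ∉ s := fun h => hd.2.2 x h x (by simp) rfl
  rcases List.eq_nil_or_concat s with rfl | ⟨s', y, rfl⟩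
  · simp at hu; exact absurd hu hxu
  cases t with
  | nil => simp at hv; exact absurd hv hxv
  | cons z t =>
    refine ⟨y, z, ?_, ?_, ?_⟩
    · exact fun h => hd.2.2 y (by simp) z (by simp) h
    · rw [predIn_append_cons hxs]; simp
    · rw [succIn_append_cons hxs]; simp

lemma Dppro.head_getLast_path {P : Set (Fin n × Fin n)} (D : Dppro G ω P) {a : Fin n × Fin n}
    (ha : a ∈ P) : (D.path a).head? = some a.1 ∧ (D.path a).getLast? = some a.2 := by
  obtain ⟨w, hw, -⟩ := D.path_shortest a ha
  rw [← hw]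
  constructor
  · rw [← w.cons_tail_support]; rfl
  · rw [List.getLast?_eq_some_getLast w.support_ne_nil, w.getLast_support]

/-- The loop body of `followPath`: at an internal vertex `cur` of the path, reached from `prev`, it
moves on to the next vertex of the path. -/
lemma exec_followPath_step (hω : ∀ e ∈ G.edgeSet, 0 < ω e) (hi : 1 ≤ i ∧ i ≤ h)
    {u v prev cur nx : Fin n}
    (ha : (u, v) ∈ landmarkPairs G ω h L i) (hadj : G.Adj cur nx)
    (hint : cur ∈ (O.dppro i).path (u, v) ∧ cur ≠ u ∧ cur ≠ v)
    (hpred : predIn ((O.dppro i).path (u, v)) cur = some prev)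
    (hsucc : succIn ((O.dppro i).path (u, v)) cur = some nx) {s : State}
    (hlev : s.reg .lev = i) (hsu : s.reg .u = u) (hsv : s.reg .v = v) (hsp : s.reg .prev = prev)
    (hsc : s.reg .cur = cur) :
    ∃ s' : State, Exec O.memory (.block
       [.read 2 [.lev, .cur] [.p, .q, .a, .b] [.w1, .w2],
        .ite (.eq .a .prev)
          (.block [.copy .nxt .b, .read 3 [.lev, .p, .q, .u, .v, .cur]
            [.junk, .junk, .junk, .nxt] [.w1, .w1, .w1, .w2], .addWt .total .w2])
          (.block [.copy .nxt .a, .read 3 [.lev, .p, .q, .u, .v, .cur]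
            [.junk, .junk, .junk, .nxt] [.w2, .w2, .w2, .w1], .addWt .total .w1]),
        .copy .prev .cur,
        .copy .cur .nxt,
        .emit .cur]) s 34 s' ∧
      s'.reg .lev = i ∧ s'.reg .u = u ∧ s'.reg .v = v ∧ s'.reg .prev = cur ∧ s'.reg .cur = nx ∧
      s'.reg .done = s.reg .done ∧ s'.stack = s.stack ∧ s'.out = s.out ++ [(nx : ℕ)] ∧
      s'.wreg .total = s.wreg .total + ω s(cur, nx) := by
  set D := O.dppro i with hD
  have hI : D.IsInternal cur := ⟨(u, v), ha, hint.1, hint.2.1, hint.2.2⟩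
  obtain ⟨hbP, hbmem, hb₁, hb₂⟩ := D.home_spec cur hI
  obtain ⟨y, z, hyz, hy, hz⟩ := exists_predIn_succIn (D.nodup_path hω hbP)
    (D.head_getLast_path hbP).1 (D.head_getLast_path hbP).2 hbmem hb₁ hb₂
  have hhome := O.lookup_home hi hI
  rw [← hD, hy, hz] at hhome
  generalize hbeq : D.home cur = b at *
  -- If the paths do not branch at `cur`, then they have the same two neighbours there.
  have hnobranch : ¬ D.IsBranching b (u, v) cur → s(some y, some z) = s(some prev, some nx) := by
    intro hnb
    by_contra hne
    refine hnb ⟨hbP, ha, fun heq => hne ?_, hbmem, hint.1, ?_⟩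
    · rw [← hy, ← hz, heq, hpred, hsucc]
    · rwa [hy, hz, hpred, hsucc]
  by_cases hbr : D.IsBranching b (u, v) cur
  · have hlook := O.lookup_branch hi hbr
    rw [← hD, hpred, hsucc, hy, hz] at hlook
    by_cases hyp : y = prev
    · refine ⟨_, .seq (.read_found _ 2 [.lev, .cur] [.p, .q, .a, .b] [.w1, .w2] _ (by
          simpa [hlev, hsc] using hhome)) (.seq (.ite_true ?_ (.seq (.copy _ _ _) (.seq
          (.read_found _ 3 [.lev, .p, .q, .u, .v, .cur]
            [.junk, .junk, .junk, .nxt] [.w1, .w1, .w1, .w2] _ (by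
              simpa [assign, hlev, hsc, hsu, hsv] using hlook)) (.seq (.addWt _ _ _) (.skip _)))))
          (.seq (.copy _ _ _) (.seq (.copy _ _ _) (.seq (.emit _ _) (.skip _))))), ?_⟩
      · simp [Cond.Holds, assign, hsp, hyp]
      · simp [assign, hlev, hsu, hsv, hsc, edgeWt_adj hadj]
    · refine ⟨_, .seq (.read_found _ 2 [.lev, .cur] [.p, .q, .a, .b] [.w1, .w2] _ (by
          simpa [hlev, hsc] using hhome)) (.seq (.ite_false ?_ (.seq (.copy _ _ _) (.seq
          (.read_found _ 3 [.lev, .p, .q, .u, .v, .cur]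
            [.junk, .junk, .junk, .nxt] [.w2, .w2, .w2, .w1] _ (by
              simpa [assign, hlev, hsc, hsu, hsv] using hlook)) (.seq (.addWt _ _ _) (.skip _)))))
          (.seq (.copy _ _ _) (.seq (.copy _ _ _) (.seq (.emit _ _) (.skip _))))), ?_⟩
      · simpa [Cond.Holds, assign, hsp, Fin.val_inj] using hyp
      · simp [assign, hlev, hsu, hsv, hsc, edgeWt_adj hadj]
  · have hlook := O.lookup_branch_eq_none hbr
    have hs := hnobranch hbr
    rw [Sym2.eq_iff] at hs
    simp only [Option.some.injEq] at hs
    by_cases hyp : y = prev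
    · obtain rfl : z = nx := by
        rcases hs with hs | hs
        · exact hs.2
        · exact absurd (hyp.trans hs.2.symm) hyz
      refine ⟨_, .seq (.read_found _ 2 [.lev, .cur] [.p, .q, .a, .b] [.w1, .w2] _ (by
          simpa [hlev, hsc] using hhome)) (.seq (.ite_true ?_ (.seq (.copy _ _ _) (.seq
          (.read_absent _ 3 [.lev, .p, .q, .u, .v, .cur]
            [.junk, .junk, .junk, .nxt] [.w1, .w1, .w1, .w2] (by
              simpa [assign, hlev, hsc, hsu, hsv] using hlook)) (.seq (.addWt _ _ _) (.skip _)))))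
          (.seq (.copy _ _ _) (.seq (.copy _ _ _) (.seq (.emit _ _) (.skip _))))), ?_⟩
      · simp [Cond.Holds, assign, hsp, hyp]
      · simp [assign, hlev, hsu, hsv, hsc, edgeWt_adj hadj]
    · obtain rfl : y = nx := by
        rcases hs with hs | hs
        · exact absurd hs.1 hyp
        · exact hs.1
      refine ⟨_, .seq (.read_found _ 2 [.lev, .cur] [.p, .q, .a, .b] [.w1, .w2] _ (by
          simpa [hlev, hsc] using hhome)) (.seq (.ite_false ?_ (.seq (.copy _ _ _) (.seq
          (.read_absent _ 3 [.lev, .p, .q, .u, .v, .cur]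
            [.junk, .junk, .junk, .nxt] [.w2, .w2, .w2, .w1] (by
              simpa [assign, hlev, hsc, hsu, hsv] using hlook)) (.seq (.addWt _ _ _) (.skip _)))))
          (.seq (.copy _ _ _) (.seq (.copy _ _ _) (.seq (.emit _ _) (.skip _))))), ?_⟩
      · simpa [Cond.Holds, assign, hsp, Fin.val_inj] using hyp
      · simp [assign, hlev, hsu, hsv, hsc, edgeWt_adj hadj]

/-- The stored path is recovered edge by edge, in constant time for each edge. -/
lemma exec_followPath (hω : ∀ e ∈ G.edgeSet, 0 < ω e) (hi : 1 ≤ i ∧ i ≤ h) {u v : Fin n}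
    (ha : (u, v) ∈ landmarkPairs G ω h L i) {s : State} (hlev : s.reg .lev = i)
    (hsu : s.reg .u = u) (hsv₀ : s.reg .v = v)
    (hsn : s.reg .nxt = code (succIn ((O.dppro i).path (u, v)) u))
    (hsw : s.wreg .w1 = edgeWt G ω u (succIn ((O.dppro i).path (u, v)) u)) :
    ∃ (t : ℕ) (s' : State) (w : G.Walk u v), Exec O.memory followPath s t s' ∧ t ≤ 35 * w.length ∧
      (walkWeight ω w : ℝ≥0∞) = wdist G ω u v ∧ s'.reg .done = s.reg .done ∧
      s'.stack = s.stack ∧ s'.out = s.out ++ w.support.tail.map Fin.val ∧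
      s'.wreg .total = s.wreg .total + walkWeight ω w := by
  set D := O.dppro i with hD
  have hnd := D.nodup_path hω ha
  have hhead := (D.head_getLast_path ha).1
  have loop : ∀ (cur : Fin n) (w : G.Walk cur v) (prev : Fin n) (pre : List (Fin n)) (s : State),
      D.path (u, v) = pre ++ prev :: w.support → s.reg .lev = i → s.reg .u = u → s.reg .v = v →
      s.reg .prev = prev → s.reg .cur = cur →
      ∃ s' : State, Exec O.memory (.while (.ne .cur .v) (.block
       [.read 2 [.lev, .cur] [.p, .q, .a, .b] [.w1, .w2],
        .ite (.eq .a .prev)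
          (.block [.copy .nxt .b, .read 3 [.lev, .p, .q, .u, .v, .cur]
            [.junk, .junk, .junk, .nxt] [.w1, .w1, .w1, .w2], .addWt .total .w2])
          (.block [.copy .nxt .a, .read 3 [.lev, .p, .q, .u, .v, .cur]
            [.junk, .junk, .junk, .nxt] [.w2, .w2, .w2, .w1], .addWt .total .w1]),
        .copy .prev .cur,
        .copy .cur .nxt,
        .emit .cur])) s (1 + 35 * w.length) s' ∧ s'.reg .done = s.reg .done ∧
        s'.stack = s.stack ∧ s'.out = s.out ++ w.support.tail.map Fin.val ∧
        s'.wreg .total = s.wreg .total + walkWeight ω w := by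
    intro cur w
    induction w with
    | nil =>
      intro prev pre s _ _ _ hsv _ hsc
      exact ⟨s, .while_false (by simp [Cond.Holds, hsc, hsv]), rfl, rfl, by simp, by simp⟩
    | @cons cur nx v hadj w ih =>
      intro prev pre s hpath hlev hsu hsv hsp hsc
      have hpath' : D.path (u, v) = (pre ++ [prev]) ++ cur :: w.support := by
        rw [hpath, SimpleGraph.Walk.support_cons]; simp
      have hnd' := hnd
      rw [hpath', List.nodup_append] at hnd'
      have hcpre : cur ∉ pre ++ [prev] := fun hc => hnd'.2.2 cur hc cur (by simp) rfl
      have hcu : cur ≠ u := by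
        rintro rfl
        rw [hpath'] at hhead
        cases pre with
        | nil => simp at hhead; exact hcpre (by simp [hhead])
        | cons x pre => simp at hhead; exact hcpre (by simp [hhead])
      have hcv : cur ≠ v := by
        rintro rfl
        exact (List.nodup_cons.1 hnd'.2.1).1 w.end_mem_support
      obtain ⟨s₁, hex, h₁, h₂, h₃, h₄, h₅, h₆, h₇, h₈, h₉⟩ := exec_followPath_step O hω hi ha hadj
        ⟨by rw [← hD, hpath']; simp, hcu, hcv⟩
        (by rw [← hD, hpath', predIn_append_cons hcpre]; simp)
        (by rw [← hD, hpath', succIn_append_cons hcpre, ← w.cons_tail_support]; rfl)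
        hlev hsu hsv hsp hsc
      obtain ⟨s₂, hex₂, k₁, k₂, k₃, k₄⟩ := ih ha hsv₀ hsn hsw hnd hhead cur (pre ++ [prev]) s₁
        hpath' h₁ h₂ h₃ h₄ h₅
      refine ⟨s₂, ?_, k₁.trans h₆, k₂.trans h₇, ?_, ?_⟩
      · have := Exec.while_true (b := .ne .cur .v) (by
          simpa [Cond.Holds, hsc, hsv, Fin.val_inj] using hcv) hex hex₂
        convert this using 1
        rw [SimpleGraph.Walk.length_cons]; ring
      · rw [k₃, h₈, List.append_assoc]
        exact congrArg (s.out ++ ·) (congrArg (List.map Fin.val) w.cons_tail_support)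
      · rw [k₄, h₉, walkWeight_cons, add_assoc]
  obtain ⟨W, hW, hd⟩ := D.path_shortest (u, v) ha
  simp only at W hW hd
  cases W with
  | nil => exact absurd rfl ha.1
  | @cons _ x _ hadj w =>
    have hsucc : succIn (D.path (u, v)) u = some x := by
      rw [← hW, SimpleGraph.Walk.support_cons]
      have := succIn_append_cons (s := []) (t := w.support) (x := u) (by simp)
      rw [List.nil_append] at this
      rw [this, ← w.cons_tail_support]; rfl
    rw [hsucc] at hsn hsw
    obtain ⟨s', hex, h₁, h₂, h₃, h₄⟩ := loop x w u []
      { reg := Function.update (Function.update s.reg .prev (s.reg .u)) .cur (s.reg .nxt)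
        wreg := Function.update s.wreg .total (s.wreg .total + s.wreg .w1)
        stack := s.stack
        out := s.out ++ [s.reg .nxt] }
      (by rw [← hW, SimpleGraph.Walk.support_cons]; rfl)
      (by simp [hlev]) (by simp [hsu]) (by simp [hsv₀]) (by simp [hsu]) (by simp [hsn])
    refine ⟨1 + (1 + (1 + (1 + (1 + 35 * w.length + 1)))), s', .cons hadj w, ?_, ?_, hd, ?_, h₂,
      ?_, ?_⟩
    · refine .seq (.copy _ _ _) (.seq (.copy _ _ _) (.seq (.addWt _ _ _) (.seq (.emit _ _)
        (.seq ?_ (.skip _)))))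
      simpa using hex
    · rw [SimpleGraph.Walk.length_cons]; omega
    · simp [h₁]
    · rw [h₃, hsn, List.append_assoc]
      exact congrArg (s.out ++ ·) (congrArg (List.map Fin.val) w.cons_tail_support)
    · rw [h₄, walkWeight_cons, ← edgeWt_adj (ω := ω) hadj, ← hsw]
      simp [add_assoc]

end Follow

/-! ### The levels of a query -/

section Query

variable {n : ℕ} {G : SimpleGraph (Fin n)} {ω : Sym2 (Fin n) → ℝ≥0} {h : ℕ} {L : ℕ → Set (Fin n)}
  (O : Oracle G ω h L) {i : ℕ}

/-- The main loop of the query algorithm. -/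
def levelLoop : Cmd :=
  .while (.isZero .done)
    (.ite (.eq .u .v)
      (.const .done 1)
      (.block
        [.read 1 [.lev, .u, .v] [.nxt, .junk] [.w1, .w2],
         .ite (.isZero .found)
           (.block
             [.incr .lev,
              .read 0 [.lev, .u] [.par] [.w1],
              .ite (.isZero .found) (.const .done 2) (.block
                [.read 0 [.lev, .v] [.par] [.w1],
                 .ite (.isZero .found) (.const .done 2) (.block [climbU, climbV])])])
           (.block [followPath, .const .done 1])]))

/-- The last part of the query algorithm: the output of the stack. -/
def unwind : Cmd := .while .stackNonempty (.block [.pop .junk, .emit .junk])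

lemma exec_unwind (M : Memory) (s : State) :
    ∃ s' : State, Exec M unwind s (1 + 4 * s.stack.length) s' ∧ s'.out = s.out ++ s.stack ∧
      s'.wreg = s.wreg := by
  obtain ⟨reg, wreg, stack, out⟩ := s
  induction stack generalizing reg out with
  | nil => exact ⟨_, .while_false (by simp [Cond.Holds]), by simp, rfl⟩
  | cons k st ih =>
    obtain ⟨s', hex, ho, hw⟩ := ih (Function.update reg .junk k) (out ++ [k])
    refine ⟨s', ?_, by simpa using ho, hw⟩
    have := Exec.while_true (M := M) (s := ⟨reg, wreg, k :: st, out⟩) (b := .stackNonempty)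
      (by simp [Cond.Holds])
      (.seq (.pop _ .junk k st rfl) (.seq (.emit _ .junk) (.skip _)))
      hex
    convert this using 1
    · rfl
    · simp only [List.length_cons]
      ring

/-- If two landmarks of a level do not form a stored pair, then both of them are close to the next
level, in comparison with their distance. -/
lemma radius_le_of_notMem {u v : Fin n} (huv : u ≠ v) (hu : u ∈ L i) (hv : v ∈ L i) (hi : i < h)
    (ha : (u, v) ∉ landmarkPairs G ω h L i) :
    radius G ω (L (i + 1)) u ≤ 3 * wdist G ω u v ∧ radius G ω (L (i + 1)) v ≤ 3 * wdist G ω u v := by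
  have hnot : ¬ (v ∈ fractionBall G ω (1 / 3) (L (i + 1)) u ∨
      u ∈ fractionBall G ω (1 / 3) (L (i + 1)) v) := fun hc =>
    ha ⟨huv, hu, hv, by rw [if_pos hi]; exact hc⟩
  rw [not_or] at hnot
  have key : ∀ {r d : ℝ≥0∞}, ¬ d < 1 / 3 * r → r ≤ 3 * d := fun {r d} hlt => by
    have := mul_le_mul_right (not_lt.1 hlt) 3
    rwa [← mul_assoc, ENNReal.mul_div_cancel (by norm_num) (by norm_num), one_mul] at this
  exact ⟨key hnot.1, by rw [wdist_comm]; exact key hnot.2⟩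

/-- The main loop reports the stored path of a pair. -/
lemma exec_levelLoop_report (hω : ∀ e ∈ G.edgeSet, 0 < ω e) (hi : 1 ≤ i ∧ i ≤ h) {u v : Fin n}
    (ha : u = v ∨ (u, v) ∈ landmarkPairs G ω h L i) {s : State} (hlev : s.reg .lev = i)
    (hsu : s.reg .u = u) (hsv : s.reg .v = v) (hdone : s.reg .done = 0) :
    ∃ (t : ℕ) (s' : State) (w : G.Walk u v), Exec O.memory levelLoop s t s' ∧
      s'.stack = s.stack ∧ s'.out = s.out ++ w.support.tail.map Fin.val ∧
      s'.wreg .total = s.wreg .total + walkWeight ω w ∧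
      (walkWeight ω w : ℝ≥0∞) = wdist G ω u v ∧ t ≤ 60 * (1 + w.length) := by
  by_cases huv : u = v
  · subst huv
    refine ⟨1 + (1 + 1) + 1, { s with reg := Function.update s.reg .done 1 }, .nil, ?_, by simp,
      by simp, by simp, by simp, by omega⟩
    exact .while_true (by simp [Cond.Holds, hdone]) (.ite_true (by simp [Cond.Holds, hsu, hsv])
      (.const _ _ _)) (.while_false (by simp [Cond.Holds]))
  replace ha := ha.resolve_left huv
  have hne : ¬ (Cond.eq .u .v).Holds s := by simpa [Cond.Holds, hsu, hsv, Fin.val_inj] using huv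
  have hlook := O.lookup_pair hi ha
  obtain ⟨t, s', w, hex, ht, hw, h₁, h₂, h₃, h₄⟩ := exec_followPath O hω hi ha
    (s := { s with
      reg := Function.update (assign s.reg [.nxt, .junk]
        [code (succIn ((O.dppro i).path (u, v)) u),
          code (predIn ((O.dppro i).path (u, v)) v)]) .found 1
      wreg := assign s.wreg [.w1, .w2] [edgeWt G ω u (succIn ((O.dppro i).path (u, v)) u),
        edgeWt G ω v (predIn ((O.dppro i).path (u, v)) v)] })
    (by simp [assign, hlev]) (by simp [assign, hsu]) (by simp [assign, hsv])
    (by simp [assign]) (by simp [assign])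
  refine ⟨1 + (1 + (9 + ((1 + (t + (1 + 1))) + 1))) + 1,
    { s' with reg := Function.update s'.reg .done 1 }, w, ?_, h₂, h₃, by simpa [assign] using h₄,
    hw, by omega⟩
  exact .while_true (by simp [Cond.Holds, hdone]) (.ite_false hne
    (.seq (.read_found _ 1 [.lev, .u, .v] [.nxt, .junk] [.w1, .w2] _ (by
      simpa [hlev, hsu, hsv] using hlook)) (.seq (.ite_false (by simp [Cond.Holds])
      (.seq hex (.seq (.const _ _ _) (.skip _)))) (.skip _))))
    (.while_false (by simp [Cond.Holds]))

/-- If there is no stored path, then one iteration of the main loop moves on to the closest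
landmarks of the next level. -/
lemma exec_levelLoop_advance (hω : ∀ e ∈ G.edgeSet, 0 < ω e) (hi : i < h) {u v : Fin n}
    (huv : u ≠ v) (ha : (u, v) ∉ landmarkPairs G ω h L i)
    (hu : radius G ω (L (i + 1)) u ≠ ⊤) (hv : radius G ω (L (i + 1)) v ≠ ⊤)
    {s : State} (hlev : s.reg .lev = i)
    (hsu : s.reg .u = u) (hsv : s.reg .v = v) (hdone : s.reg .done = 0) :
    ∃ (t : ℕ) (s' : State) (p : G.Walk u ((O.forest (i + 1)).near u))
      (q : G.Walk v ((O.forest (i + 1)).near v)),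
      (∀ t' s'', Exec O.memory levelLoop s' t' s'' → Exec O.memory levelLoop s (t + t') s'') ∧
      t ≤ 54 + 11 * (p.length + q.length) ∧
      (walkWeight ω p : ℝ≥0∞) = radius G ω (L (i + 1)) u ∧
      (walkWeight ω q : ℝ≥0∞) = radius G ω (L (i + 1)) v ∧
      s'.reg .lev = i + 1 ∧ s'.reg .u = (O.forest (i + 1)).near u ∧
      s'.reg .v = (O.forest (i + 1)).near v ∧ s'.reg .done = 0 ∧
      s'.stack = q.reverse.support.tail.map Fin.val ++ s.stack ∧
      s'.out = s.out ++ p.support.tail.map Fin.val ∧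
      s'.wreg .total = s.wreg .total + walkWeight ω p + walkWeight ω q := by
  have hi' : 1 ≤ i + 1 ∧ i + 1 ≤ h := ⟨by omega, hi⟩
  have hne : ¬ (Cond.eq .u .v).Holds s := by simpa [Cond.Holds, hsu, hsv, Fin.val_inj] using huv
  have hpair := O.lookup_pair_eq_none ha
  have hlu := O.lookup_tree hi' hu
  have hlv := O.lookup_tree hi' hv
  set F := O.forest (i + 1) with hF
  let r₀ := Function.update s.reg .found 0
  let r₁ := Function.update r₀ .lev (r₀ .lev + 1)
  let r₂ := Function.update (assign r₁ [.par] [(F.parent u : ℕ)]) .found 1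
  let r₃ := Function.update (assign r₂ [.par] [(F.parent v : ℕ)]) .found 1
  let w₂ := assign s.wreg [.w1] [edgeWt G ω u (some (F.parent u))]
  let w₃ := assign w₂ [.w1] [edgeWt G ω v (some (F.parent v))]
  obtain ⟨tu, s₁, p, hexu, htu, hpw, a₁, a₂, a₃, a₄, a₅, a₆, a₇⟩ := exec_climbU O hω hi' hu
    (s := ⟨r₃, w₃, s.stack, s.out⟩) (by simp [r₃, r₂, r₁, r₀, assign, hlev])
    (by simp [r₃, r₂, r₁, r₀, assign, hsu])
  obtain ⟨tv, s₂, q, hexv, htv, hqw, b₁, b₂, b₃, b₄, b₅, b₆, b₇⟩ := exec_climbV O hω hi' hv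
    (s := s₁) a₂ (by simp [a₃, r₃, r₂, r₁, r₀, assign, hsv])
  refine ⟨1 + (1 + (9 + ((1 + (1 + (6 + ((1 + (6 + ((1 + (tu + (tv + 1))) + 1))) + 1)))) + 1))),
    s₂, p, q, fun t' s'' hex => ?_, by omega, hpw, hqw, b₂, b₃.trans a₁, b₁, ?_, ?_, ?_, ?_⟩
  · exact .while_true (by simp [Cond.Holds, hdone]) (.ite_false hne
      (.seq (.read_absent _ 1 [.lev, .u, .v] [.nxt, .junk] [.w1, .w2] (by
        simpa [hlev, hsu, hsv] using hpair)) (.seq (.ite_true (by simp [Cond.Holds])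
        (.seq (.incr _ _) (.seq (.read_found _ 0 [.lev, .u] [.par] [.w1] _ (by
          simpa [hlev, hsu] using hlu)) (.seq (.ite_false (by simp [Cond.Holds])
          (.seq (.read_found _ 0 [.lev, .v] [.par] [.w1] _ (by
            simpa [assign, hlev, hsv] using hlv)) (.seq (.ite_false (by simp [Cond.Holds])
            (.seq hexu (.seq hexv (.skip _)))) (.skip _)))) (.skip _)))))
        (.skip _)))) hex
  · rw [b₄, a₄]; simp [r₃, r₂, r₁, r₀, assign, hdone]
  · rw [b₅, a₅]
  · rw [b₆, a₆]
  · rw [b₇, a₇]; simp [w₃, w₂, assign]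

/-- The main loop, started on level `i`. The stretch grows by the factor 7 with each level: if the
current vertices have distance `d`, then both of them are at most `3 d` away from their successors,
whose distance is therefore at most `7 d`. If the landmark sets are disjoint, then every level above
the first one contributes at least one edge to the path. -/
lemma exec_levelLoop (hω : ∀ e ∈ G.edgeSet, 0 < ω e) (k : ℕ) :
    ∀ i : ℕ, 1 ≤ i → i + k = h → ∀ u v : Fin n, G.Reachable u v → u ∈ L i → v ∈ L i →
    ∀ s : State, s.reg .lev = i → s.reg .u = u → s.reg .v = v → s.reg .done = 0 →
    ∃ (t : ℕ) (s' : State) (w : G.Walk u v), Exec O.memory levelLoop s t s' ∧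
      s'.out ++ s'.stack = s.out ++ w.support.tail.map Fin.val ++ s.stack ∧
      s.out.length ≤ s'.out.length ∧
      s'.wreg .total = s.wreg .total + walkWeight ω w ∧
      (walkWeight ω w : ℝ≥0∞) ≤ ((2 * 7 ^ k - 1 : ℕ) : ℝ≥0∞) * wdist G ω u v ∧
      t ≤ 60 * (k + 1 + w.length) ∧
      ((∀ i j, 2 ≤ i → i < j → j ≤ h → Disjoint (L i) (L j)) →
        t ≤ 60 * (1 + (if i = 1 then 1 else 0) + 2 * w.length)) := by
  induction k with
  | zero =>
    intro i hi hik u v hr hu hv s hlev hsu hsv hdone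
    obtain rfl : i = h := by omega
    have ha : u = v ∨ (u, v) ∈ landmarkPairs G ω i L i := by
      by_cases huv : u = v
      · exact .inl huv
      · exact .inr ⟨huv, hu, hv, by rw [if_neg (lt_irrefl i)]; exact hr⟩
    obtain ⟨t, s', w, hex, h₁, h₂, h₃, h₄, h₅⟩ :=
      exec_levelLoop_report O hω ⟨hi, le_rfl⟩ ha hlev hsu hsv hdone
    exact ⟨t, s', w, hex, by rw [h₁, h₂], by simp [h₂], h₃, by simp [h₄], by omega,
      fun _ => by omega⟩
  | succ k ih =>
    intro i hi hik u v hr hu hv s hlev hsu hsv hdone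
    have hpow : 1 ≤ 7 ^ k := Nat.one_le_pow _ _ (by norm_num)
    by_cases ha : u = v ∨ (u, v) ∈ landmarkPairs G ω h L i
    · obtain ⟨t, s', w, hex, h₁, h₂, h₃, h₄, h₅⟩ :=
        exec_levelLoop_report O hω ⟨hi, by omega⟩ ha hlev hsu hsv hdone
      refine ⟨t, s', w, hex, by rw [h₁, h₂], by simp [h₂], h₃, ?_, by omega, fun _ => by omega⟩
      rw [h₄]
      refine le_mul_of_one_le_left zero_le ?_
      exact_mod_cast (by rw [pow_succ]; omega : 1 ≤ 2 * 7 ^ (k + 1) - 1)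
    · rw [not_or] at ha
      have hih : i < h := by omega
      obtain ⟨hru, hrv⟩ := radius_le_of_notMem ha.1 hu hv hih ha.2
      have hd : wdist G ω u v ≠ ⊤ := (wdist_ne_top_iff ω).2 hr
      have htop : 3 * wdist G ω u v ≠ ⊤ := ENNReal.mul_ne_top (by norm_num) hd
      have hu' := ne_top_of_le_ne_top htop hru
      have hv' := ne_top_of_le_ne_top htop hrv
      have hadv := exec_levelLoop_advance O hω hih ha.1 ha.2 hu' hv' hlev hsu hsv hdone
      set F := O.forest (i + 1)
      obtain ⟨t, s₁, p, q, hex, ht, hp, hq, a₁, a₂, a₃, a₄, a₅, a₆, a₇⟩ := hadv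
      have hnear : wdist G ω (F.near u) (F.near v) ≤ 7 * wdist G ω u v := by
        calc wdist G ω (F.near u) (F.near v)
            ≤ wdist G ω (F.near u) u + (wdist G ω u v + wdist G ω v (F.near v)) :=
              (wdist_triangle ω _ u _).trans (add_le_add_right (wdist_triangle ω _ _ _) _)
          _ ≤ 3 * wdist G ω u v + (wdist G ω u v + 3 * wdist G ω u v) := by
              rw [wdist_comm, F.near_closest u hu', F.near_closest v hv']
              gcongr
          _ = 7 * wdist G ω u v := by ring
      obtain ⟨t', s', w, hex', b₁, b₂, b₃, b₄, b₅, b₆⟩ := ih (i + 1) (by omega) (by omega)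
        (F.near u) (F.near v) ((p.reachable.symm.trans hr).trans q.reachable) (F.near_mem u hu')
        (F.near_mem v hv') s₁ a₁ a₂ a₃ a₄
      refine ⟨t + t', s', (p.append w).append q.reverse, hex _ _ hex', ?_, ?_, ?_, ?_, ?_, ?_⟩
      · rw [b₁, a₅, a₆]
        simp [SimpleGraph.Walk.tail_support_append]
      · rw [a₆, List.length_append] at b₂
        omega
      · rw [b₃, a₇, walkWeight_append, walkWeight_append, walkWeight_reverse]
        ring
      · rw [walkWeight_append, walkWeight_append, walkWeight_reverse]
        rw [ENNReal.coe_add, ENNReal.coe_add]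
        have hnum : ((2 * 7 ^ (k + 1) - 1 : ℕ) : ℝ≥0∞) = 6 + ((2 * 7 ^ k - 1 : ℕ) : ℝ≥0∞) * 7 := by
          exact_mod_cast (by rw [pow_succ]; omega :
            2 * 7 ^ (k + 1) - 1 = 6 + (2 * 7 ^ k - 1) * 7)
        rw [hp, hq, hnum]
        calc radius G ω (L (i + 1)) u + (walkWeight ω w : ℝ≥0∞) + radius G ω (L (i + 1)) v
            ≤ 3 * wdist G ω u v + ((2 * 7 ^ k - 1 : ℕ) : ℝ≥0∞) * (7 * wdist G ω u v) +
              3 * wdist G ω u v :=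
              add_le_add (add_le_add hru (b₄.trans (mul_le_mul_right hnear _))) hrv
          _ = _ := by ring
      · simp only [SimpleGraph.Walk.length_append, SimpleGraph.Walk.length_reverse]
        omega
      · intro hdisj
        have h₂ := b₆ hdisj
        rw [if_neg (by omega)] at h₂
        simp only [SimpleGraph.Walk.length_append, SimpleGraph.Walk.length_reverse]
        by_cases hi₁ : i = 1
        · rw [if_pos hi₁]
          omega
        · rw [if_neg hi₁]
          -- `u` is a landmark of level `i ≥ 2`, hence none of level `i + 1`
          have : 1 ≤ p.length := by
            by_contra hlt
            have heq := SimpleGraph.Walk.eq_of_length_eq_zero (p := p) (by omega)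
            refine Set.disjoint_left.1 (hdisj i (i + 1) (by omega) (by omega) (by omega)) hu ?_
            rw [heq]
            exact F.near_mem u hu'
          omega

/-- The whole query: the reported walk, its length and the time. -/
lemma exec_query (hω : ∀ e ∈ G.edgeSet, 0 < ω e) (hh : 1 ≤ h) (hL : L 1 = Set.univ) {u v : Fin n}
    (hr : G.Reachable u v) :
    ∃ (t : ℕ) (w : G.Walk u v), Reports ω O.memory t w ∧
      (walkWeight ω w : ℝ≥0∞) ≤ ((2 * 7 ^ (h - 1) - 1 : ℕ) : ℝ≥0∞) * wdist G ω u v ∧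
      t ≤ 70 * (h + w.length) ∧
      ((∀ i j, 2 ≤ i → i < j → j ≤ h → Disjoint (L i) (L j)) → t ≤ 140 * (1 + w.length)) := by
  obtain ⟨t, s₁, w, hex, h₁, h₂, h₃, h₄, h₅, h₆⟩ := exec_levelLoop O hω (h - 1) 1 le_rfl (by omega)
    u v hr (by simp [hL]) (by simp [hL])
    { reg := Function.update (Function.update (initState u v).reg .lev 1) .done 0
      wreg := (initState u v).wreg
      stack := (initState u v).stack
      out := (initState u v).out ++ [(initState u v).reg .u] }
    (by simp) (by simp [initState]) (by simp [initState]) (by simp)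
  obtain ⟨s₂, hex₂, ho, hw⟩ := exec_unwind O.memory s₁
  have hlen := congrArg List.length h₁
  simp [initState] at hlen h₂
  refine ⟨1 + (1 + (1 + (t + ((1 + 4 * s₁.stack.length) + 1)))), w, ⟨s₂, ?_, ?_, ?_⟩, h₄, ?_, ?_⟩
  · exact .seq (.emit _ _) (.seq (.const _ _ _) (.seq (.const _ _ _) (.seq hex
      (.seq hex₂ (.skip _)))))
  · have hcons : w.support.map Fin.val = (u : ℕ) :: w.support.tail.map Fin.val :=
      (congrArg (List.map Fin.val) w.cons_tail_support).symm
    have hout : s₂.out = w.support.map Fin.val := by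
      rw [ho, h₁, hcons]
      simp [initState]
    rw [hout]
    simp [List.map_eq_flatMap]
  · rw [hw, h₃]; simp [initState]
  · omega
  · intro hdisj
    have := h₆ hdisj
    simp at this
    omega

end Query

section Asymptotics

variable {n : ℕ}

/-! ### The number of levels against the iterated logarithm -/

lemma one_lt_log (hn : 3 ≤ n) : 1 < Real.log n := by
  rw [Real.lt_log_iff_exp_lt (by positivity)]
  calc Real.exp 1 < 3 := by linarith [Real.exp_one_lt_d9]
    _ ≤ n := by exact_mod_cast hn

lemma log_log_three_pos : 0 < Real.log (Real.log 3) :=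
  Real.log_pos (by exact_mod_cast one_lt_log le_rfl)

lemma log_log_three_le (hn : 3 ≤ n) : Real.log (Real.log 3) ≤ Real.log (Real.log n) := by
  have h : (1 : ℝ) < Real.log 3 := by exact_mod_cast one_lt_log le_rfl
  have hn' : (3 : ℝ) ≤ n := by exact_mod_cast hn
  exact Real.log_le_log (by linarith) (Real.log_le_log (by norm_num) hn')

lemma pow_levels_le (hn : 3 ≤ n) :
    (4 / 3 : ℝ) ^ (levels n - 1) ≤ ((Real.log 2)⁻¹ + 1) * Real.log n := by
  refine (lt_logb_add_one hn).le.trans ?_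
  have := one_lt_log hn
  rw [Real.logb, div_eq_inv_mul]
  linarith

lemma exists_levels_le : ∃ c : ℝ, 0 < c ∧ ∀ n : ℕ, 3 ≤ n →
    (levels n : ℝ) ≤ c * Real.log (Real.log n) := by
  have hδ := log_log_three_pos
  set δ := Real.log (Real.log 3)
  set a := (Real.log 2)⁻¹ + 1
  set b := Real.log (4 / 3)
  have hb : 0 < b := Real.log_pos (by norm_num)
  have ha : 1 ≤ a := le_add_of_nonneg_left (inv_nonneg.2 (Real.log_nonneg one_le_two))
  have hla : 0 ≤ Real.log a := Real.log_nonneg ha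
  refine ⟨1 / δ + (Real.log a / δ + 1) / b, by positivity, fun n hn => ?_⟩
  have hlog := one_lt_log hn
  have h₀ := Real.log_le_log (by positivity) (pow_levels_le hn)
  rw [Real.log_pow, Real.log_mul (by positivity) (by positivity),
    Nat.cast_sub (levels_pos hn), Nat.cast_one] at h₀
  have h₁ : 1 ≤ Real.log (Real.log n) / δ := (one_le_div hδ).2 (log_log_three_le hn)
  have h₂ : Real.log a ≤ Real.log a * (Real.log (Real.log n) / δ) :=
    le_mul_of_one_le_right hla h₁
  have h₃ : (levels n : ℝ) - 1 ≤
      (Real.log a * (Real.log (Real.log n) / δ) + Real.log (Real.log n)) / b := by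
    rw [le_div_iff₀ hb]
    exact h₀.trans (by linarith)
  calc (levels n : ℝ) ≤ Real.log (Real.log n) / δ +
        (Real.log a * (Real.log (Real.log n) / δ) + Real.log (Real.log n)) / b := by linarith
    _ = _ := by ring

lemma exists_stretch_le : ∃ c : ℝ, 0 < c ∧ ∀ n : ℕ, 3 ≤ n →
    ((2 * 7 ^ (levels n - 1) - 1 : ℕ) : ℝ) ≤ c * Real.log n ^ Real.logb (4 / 3) 7 := by
  set β := Real.logb (4 / 3) 7
  have hβ : 0 ≤ β := Real.logb_nonneg (by norm_num) (by norm_num)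
  have ha : 0 < (Real.log 2)⁻¹ + 1 := by
    have := Real.log_pos one_lt_two
    positivity
  refine ⟨2 * ((Real.log 2)⁻¹ + 1) ^ β, by positivity, fun n hn => ?_⟩
  have hlog := one_lt_log hn
  have hpow : ((4 / 3 : ℝ) ^ (levels n - 1)) ^ β = 7 ^ (levels n - 1) := by
    rw [← Real.rpow_natCast, ← Real.rpow_mul (by norm_num), mul_comm, Real.rpow_mul (by norm_num),
      Real.rpow_logb (by norm_num) (by norm_num) (by norm_num), Real.rpow_natCast]
  calc ((2 * 7 ^ (levels n - 1) - 1 : ℕ) : ℝ) ≤ ((2 * 7 ^ (levels n - 1) : ℕ) : ℝ) := by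
        exact_mod_cast Nat.sub_le _ _
    _ = 2 * ((4 / 3 : ℝ) ^ (levels n - 1)) ^ β := by rw [hpow]; push_cast; rfl
    _ ≤ 2 * (((Real.log 2)⁻¹ + 1) * Real.log n) ^ β := by
        gcongr
        exact pow_levels_le hn
    _ = _ := by rw [Real.mul_rpow ha.le (by linarith)]; ring

end Asymptotics

end PathOracle

open PathOracle in
theorem theorem4 :
    ∃ C : ℝ, 0 < C ∧ ∀ n : ℕ, 3 ≤ n →
      (∀ᵐ S ∂sampling n, landmarks S 1 = Set.univ) ∧
      ∀ (G : SimpleGraph (Fin n)) (ω : Sym2 (Fin n) → ℝ≥0), (∀ e ∈ G.edgeSet, 0 < ω e) →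
        (∀ L : ℕ → Set (Fin n), Nonempty (Oracle G ω (levels n) L)) ∧
        (∀ O : ∀ S : Sample n, Oracle G ω (levels n) (landmarks S),
          ∫⁻ S, ((O S).memory.space : ℝ≥0∞) ∂sampling n
            ≤ ENNReal.ofReal (C * (n * Real.log (Real.log n)))) ∧
        (∀ O : ∀ S : Sample n, Oracle G ω (levels n) (disjointLandmarks S),
          ∫⁻ S, ((O S).memory.space : ℝ≥0∞) ∂sampling n
            ≤ ENNReal.ofReal (C * (n * Real.log (Real.log n)))) ∧
        ∀ (L : ℕ → Set (Fin n)) (O : Oracle G ω (levels n) L), L 1 = Set.univ →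
          (∀ e ∈ O.memory, ∀ k ∈ e.key ++ e.ids, (k : ℝ) ≤ C * n) ∧
          ∀ u v : Fin n, G.Reachable u v → ∃ (t : ℕ) (p : G.Walk u v),
            Reports ω O.memory t p ∧
            wdist G ω u v ≤ walkWeight ω p ∧
            (walkWeight ω p : ℝ) ≤
              C * Real.log n ^ Real.logb (4 / 3) 7 * (wdist G ω u v).toReal ∧
            (t : ℝ) ≤ C * (Real.log (Real.log n) + p.length) ∧
            ((∀ i j, 2 ≤ i → i < j → j ≤ levels n → Disjoint (L i) (L j)) →
              (t : ℝ) ≤ C * (1 + p.length)) := by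
  obtain ⟨c₁, hc₁, hlev⟩ := exists_levels_le
  obtain ⟨c₂, hc₂, hstr⟩ := exists_stretch_le
  have hK := clusterConst_nonneg
  set K := 30 + 180 * clusterConst with hKdef
  have hKc : 0 ≤ K * c₁ := by positivity
  refine ⟨K * c₁ + 70 * c₁ + c₂ + 140, by positivity, fun n hn => ?_⟩
  set C := K * c₁ + 70 * c₁ + c₂ + 140 with hC
  have hlog := one_lt_log hn
  have hlev := hlev n hn
  have hstr := hstr n hn
  have hLL : 0 < Real.log (Real.log n) := log_log_three_pos.trans_le (log_log_three_le hn)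
  have hspace : ENNReal.ofReal (K * n * levels n) ≤
      ENNReal.ofReal (C * (n * Real.log (Real.log n))) := by
    refine ENNReal.ofReal_le_ofReal ?_
    calc K * n * levels n ≤ K * n * (c₁ * Real.log (Real.log n)) := by gcongr
      _ = K * c₁ * (n * Real.log (Real.log n)) := by ring
      _ ≤ C * (n * Real.log (Real.log n)) := by gcongr; linarith
  refine ⟨sampling_landmarks_one hn, fun G ω hω => ⟨nonempty_oracle hω _, fun O => ?_, fun O => ?_,
    fun L O hL => ⟨fun e he k hk => ?_, fun u v hr => ?_⟩⟩⟩
  · exact (lintegral_space_le hn hω (fun _ _ => le_rfl) disjointLandmarks_subset O).trans hspace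
  · exact (lintegral_space_le hn hω disjointLandmarks_subset (fun _ _ => le_rfl) O).trans hspace
  · have h₁ : (k : ℝ) ≤ n + levels n := by exact_mod_cast O.word_le hn he hk
    have h₂ : Real.log (Real.log n) ≤ n :=
      (Real.log_le_self (by linarith)).trans (Real.log_le_self (by positivity))
    calc (k : ℝ) ≤ n + c₁ * Real.log (Real.log n) := h₁.trans (by gcongr)
      _ ≤ n + c₁ * n := by gcongr
      _ = (1 + c₁) * n := by ring
      _ ≤ C * n := by gcongr; linarith
  · obtain ⟨t, p, hrep, hw, ht, ht'⟩ := exec_query O hω (levels_pos hn) hL hr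
    have hd : wdist G ω u v ≠ ⊤ := (wdist_ne_top_iff ω).2 hr
    refine ⟨t, p, hrep, wdist_le_walkWeight ω p, ?_, ?_, fun hdisj => ?_⟩
    · have h := ENNReal.toReal_mono (ENNReal.mul_ne_top (ENNReal.natCast_ne_top _) hd) hw
      rw [ENNReal.toReal_mul, ENNReal.toReal_natCast, ENNReal.coe_toReal] at h
      refine h.trans ?_
      gcongr
      refine hstr.trans ?_
      gcongr
      linarith
    · have h : (t : ℝ) ≤ 70 * (levels n + p.length) := by exact_mod_cast ht
      calc (t : ℝ) ≤ 70 * (c₁ * Real.log (Real.log n) + p.length) := h.trans (by gcongr)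
        _ = 70 * c₁ * Real.log (Real.log n) + 70 * p.length := by ring
        _ ≤ C * Real.log (Real.log n) + C * p.length := by gcongr <;> linarith
        _ = _ := by ring
    · have h : (t : ℝ) ≤ 140 * (1 + p.length) := by exact_mod_cast ht' hdisj
      refine h.trans ?_
      gcongr
      linarith
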